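/- Let $\omega\subset\mathbb{R}^2$ be an open set with area $|\omega|=1$ (for instance a bounded domain), let $\Omega_1=\omega\times(0,1)\subset\mathbb{R}^3$, let $\alpha>0$ and $m_s>0$, and let $\varphi:\mathbb{R}^3\to[0,\infty)$ be continuous. Functions on $\Omega_1$ are extended by zero to $\mathbb{R}^3$ where needed, and differential operators are understood in the sense of distributions. For $\epsilon>0$ put $\nabla_\epsilon=(\partial_1,\partial_2,\tfrac1\epsilon\partial_3)^T$, $\nabla'=(\partial_1,\partial_2)^T$, $\operatorname{div}_\epsilon=\nabla_\epsilon\cdot$, $\operatorname{curl}_\epsilon=\nabla_\epsilon\times$, and $$\mathcal{U}_\epsilon=\Bigl\{(m,h)\in W^{1,2}(\Omega_1;\mathbb{R}^3)\times L^2(\mathbb{R}^3;\mathbb{R}^3):\ \operatorname{div}_\epsilon(m+h)=0,\ \operatorname{curl}_\epsilon h=0\ \text{in }\mathbb{R}^3,\ |m|=m_s\ \text{a.e. in }\Omega_1\Bigr\},$$ $$\mathcal{U}_0=\Bigl\{(m,h)\in W^{1,2}(\Omega_1;\mathbb{R}^3)\times L^2(\mathbb{R}^3;\mathbb{R}^3):\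 \mathcal{A}_0^{\rm mag}(m,h)=0\ \text{in }\mathbb{R}^3,\ \partial_3 m=0\ \text{in }\Omega_1,\ |m|=m_s\ \text{a.e. in }\Omega_1\Bigr\},$$ where $$\mathcal{A}_0^{\rm mag}(m,h)=\bigl(\partial_3(m_3+h_3),\ -\partial_3h_2,\ \partial_3h_1,\ \partial_1h_2-\partial_2h_1\bigr)^T.$$ For $(m,h)\in W^{1,2}(\Omega_1;\mathbb{R}^3)\times L^2(\mathbb{R}^3;\mathbb{R}^3)$ define $$F_\epsilon[m,h]=\int_{\Omega_1}\alpha|\nabla_\epsilon m|^2+\varphi(m)\,dx+\frac12\int_{\mathbb{R}^3}|h|^2\,dx\ \text{ if }(m,h)\in\mathcal{U}_\epsilon,\qquad F_\epsilon[m,h]=\infty\ \text{ otherwise},$$ $$F_0[m,h]=\int_{\Omega_1}\alpha|\nabla' m|^2+\varphi(m)\,dx+\frac12\int_{\mathbb{R}^3}|h|^2\,dx\ \text{ if }(m,h)\in\mathcal{U}_0,\qquad F_0[m,h]=\infty\ \text{ otherwise}.$$ (a) $F_0$ is the $\Gamma$-limit of $F_\epsilon$ as $\epsilon\to0^+$ with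 respect to weak convergence in $W^{1,2}(\Omega_1;\mathbb{R}^3)\times L^2(\mathbb{R}^3;\mathbb{R}^3)$. That is, for every sequence $\epsilon_j>0$ with $\epsilon_j\to0$: whenever $(m_j,h_j)\rightharpoonup(m,h)$, one has $F_0[m,h]\le\liminf_{j\to\infty}F_{\epsilon_j}[m_j,h_j]$; and for every $(m,h)$ there is a sequence $(m_j,h_j)\rightharpoonup(m,h)$ with $\limsup_{j\to\infty}F_{\epsilon_j}[m_j,h_j]\le F_0[m,h]$. (b) Compactness: if $\epsilon_j>0$, $\epsilon_j\to0$ and $F_{\epsilon_j}[m_j,h_j]\le C<\infty$ for all $j$, then a subsequence of $(m_j,h_j)$ converges weakly in $W^{1,2}(\Omega_1;\mathbb{R}^3)\times L^2(\mathbb{R}^3;\mathbb{R}^3)$ to some $(m,h)\in\mathcal{U}_0$. -/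

import Mathlib

open MeasureTheory Filter Topology TopologicalSpace Distributions
open scoped ENNReal NNReal

noncomputable section

namespace ThinFilm

/-- The plane, with its Euclidean norm. -/
abbrev E2 : Type := EuclideanSpace ℝ (Fin 2)

/-- The space, with its Euclidean norm. The coordinates `x₁, x₂, x₃` carry the indices `0, 1, 2`. -/
abbrev E3 : Type := EuclideanSpace ℝ (Fin 3)

/-- The classical partial derivative `∂ᵢ ψ` of a smooth function. -/
def partialDeriv (i : Fin 3) (ψ : E3 → ℝ) (x : E3) : ℝ :=
  fderiv ℝ ψ x (EuclideanSpace.single i 1)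

/-! ### The Sobolev space `W^{1,2}(Ω; ℝ³)` -/

/-- `L²(Ω; ℝ³)`. -/
abbrev L2 (Ω : Opens E3) : Type := Lp E3 2 (volume.restrict (Ω : Set E3))

/-- `g` is the weak `i`-th partial derivative of `u` in `Ω`:
`∫_Ω (∂ᵢ ψ) u = - ∫_Ω ψ g` for all `ψ ∈ C_c^∞(Ω)`. -/
def IsWeakPartialDeriv (Ω : Opens E3) (i : Fin 3) (u g : L2 Ω) : Prop :=
  ∀ ψ : 𝓓(Ω, ℝ),
    ∫ x in (Ω : Set E3), partialDeriv i ψ x • u x = - ∫ x in (Ω : Set E3), ψ x • g x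

theorem integrable_test_smul (Ω : Opens E3) (ψ : 𝓓(Ω, ℝ)) (u : L2 Ω) :
    Integrable (fun x => ψ x • u x) (volume.restrict (Ω : Set E3)) := by
  have h1 : MemLp (fun x => ψ x) 2 (volume.restrict (Ω : Set E3)) :=
    ψ.continuous.memLp_of_hasCompactSupport ψ.hasCompactSupport
  exact memLp_one_iff_integrable.1 ((Lp.memLp u).smul h1)

theorem integrable_partialDeriv_smul (Ω : Opens E3) (i : Fin 3) (ψ : 𝓓(Ω, ℝ)) (u : L2 Ω) :
    Integrable (fun x => partialDeriv i ψ x • u x) (volume.restrict (Ω : Set E3)) := by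
  have hc : Continuous (partialDeriv i ψ) :=
    (ψ.contDiff.continuous_fderiv (by simp)).clm_apply continuous_const
  have hs : HasCompactSupport (partialDeriv i ψ) :=
    ψ.hasCompactSupport.fderiv_apply (𝕜 := ℝ) (EuclideanSpace.single i 1)
  have h1 : MemLp (partialDeriv i ψ) 2 (volume.restrict (Ω : Set E3)) :=
    hc.memLp_of_hasCompactSupport hs
  exact memLp_one_iff_integrable.1 ((Lp.memLp u).smul h1)

theorem isWeakPartialDeriv_zero (Ω : Opens E3) (i : Fin 3) :
    IsWeakPartialDeriv Ω i 0 0 := by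
  intro ψ
  have h := Lp.coeFn_zero E3 2 (volume.restrict (Ω : Set E3))
  rw [integral_eq_zero_of_ae, integral_eq_zero_of_ae, neg_zero]
  · filter_upwards [h] with x hx
    rw [hx]
    exact smul_zero _
  · filter_upwards [h] with x hx
    rw [hx]
    exact smul_zero _

theorem IsWeakPartialDeriv.add {Ω : Opens E3} {i : Fin 3} {u v g k : L2 Ω}
    (hu : IsWeakPartialDeriv Ω i u g) (hv : IsWeakPartialDeriv Ω i v k) :
    IsWeakPartialDeriv Ω i (u + v) (g + k) := by
  intro ψ
  have e1 : ∫ x in (Ω : Set E3), partialDeriv i ψ x • (u + v : L2 Ω) x =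
      ∫ x in (Ω : Set E3), (partialDeriv i ψ x • u x + partialDeriv i ψ x • v x) := by
    refine integral_congr_ae ?_
    filter_upwards [Lp.coeFn_add u v] with x hx
    rw [hx]
    exact smul_add _ _ _
  have e2 : ∫ x in (Ω : Set E3), ψ x • (g + k : L2 Ω) x =
      ∫ x in (Ω : Set E3), (ψ x • g x + ψ x • k x) := by
    refine integral_congr_ae ?_
    filter_upwards [Lp.coeFn_add g k] with x hx
    rw [hx]
    exact smul_add _ _ _
  rw [e1, e2, integral_add (integrable_partialDeriv_smul Ω i ψ u)
    (integrable_partialDeriv_smul Ω i ψ v), integral_add (integrable_test_smul Ω ψ g)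
    (integrable_test_smul Ω ψ k), hu ψ, hv ψ, neg_add]

theorem IsWeakPartialDeriv.smul {Ω : Opens E3} {i : Fin 3} {u g : L2 Ω} (c : ℝ)
    (hu : IsWeakPartialDeriv Ω i u g) : IsWeakPartialDeriv Ω i (c • u) (c • g) := by
  intro ψ
  have e1 : ∫ x in (Ω : Set E3), partialDeriv i ψ x • (c • u : L2 Ω) x =
      ∫ x in (Ω : Set E3), c • (partialDeriv i ψ x • u x) := by
    refine integral_congr_ae ?_
    filter_upwards [Lp.coeFn_smul c u] with x hx
    simp only [hx, Pi.smul_apply]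
    exact smul_comm _ _ _
  have e2 : ∫ x in (Ω : Set E3), ψ x • (c • g : L2 Ω) x =
      ∫ x in (Ω : Set E3), c • (ψ x • g x) := by
    refine integral_congr_ae ?_
    filter_upwards [Lp.coeFn_smul c g] with x hx
    simp only [hx, Pi.smul_apply]
    exact smul_comm _ _ _
  rw [e1, e2, integral_smul, integral_smul, hu ψ, smul_neg]

/-- `W^{1,2}(Ω; ℝ³)`: the pairs `(u, (∂₁u, ∂₂u, ∂₃u))` of an `L²` field and its weak partial
derivatives in `L²`, with the norm `(‖u‖² + ∑ᵢ ‖∂ᵢu‖²)^{1/2}`. (Weak derivatives being unique,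
the pair is determined by `u`.) -/
def W12 (Ω : Opens E3) : Submodule ℝ (WithLp 2 (L2 Ω × PiLp 2 (fun _ : Fin 3 => L2 Ω))) where
  carrier := {p | ∀ i, IsWeakPartialDeriv Ω i p.fst (p.snd i)}
  zero_mem' i := isWeakPartialDeriv_zero Ω i
  add_mem' ha hb i := (ha i).add (hb i)
  smul_mem' c _ ha i := (ha i).smul c

/-- The field underlying an element of `W^{1,2}`. -/
def field {Ω : Opens E3} (m : W12 Ω) : L2 Ω := (m : WithLp 2 (L2 Ω × PiLp 2 (fun _ : Fin 3 => L2 Ω))).fst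

/-- The weak partial derivative `∂ᵢ m ∈ L²(Ω; ℝ³)`. -/
def weakDeriv {Ω : Opens E3} (i : Fin 3) (m : W12 Ω) : L2 Ω :=
  (m : WithLp 2 (L2 Ω × PiLp 2 (fun _ : Fin 3 => L2 Ω))).snd i

/-- The extension of `m` by zero to the whole space. -/
def zeroExt {Ω : Opens E3} (m : W12 Ω) : E3 → E3 := (Ω : Set E3).indicator (field m)

/-! ### Distributional differential operators on the whole space -/

/-- `L²(ℝ³; ℝ³)`. -/
abbrev L2Space : Type := Lp E3 2 (volume : Measure E3)

/-- The distributional partial derivative `∂ᵢ f` on `ℝ³`: the functional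
`ψ ↦ - ∫ f ∂ᵢψ` on `C_c^∞(ℝ³)`. -/
def distDeriv (i : Fin 3) (f : E3 → ℝ) : 𝓓((⊤ : Opens E3), ℝ) → ℝ :=
  fun ψ => - ∫ x, f x * partialDeriv i ψ x

/-- The components of the rescaled gradient `∇_ε = (∂₁, ∂₂, ε⁻¹ ∂₃)`, as distributions. -/
def distDerivEps (ε : ℝ) (i : Fin 3) (f : E3 → ℝ) : 𝓓((⊤ : Opens E3), ℝ) → ℝ :=
  (if i = 2 then ε⁻¹ else 1) • distDeriv i f

/-- The rescaled operator `(div_ε (m + h), curl_ε h)` with `div_ε = ∇_ε ·`, `curl_ε = ∇_ε ×`. -/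
def Aeps (ε : ℝ) (m h : E3 → E3) : Fin 4 → 𝓓((⊤ : Opens E3), ℝ) → ℝ :=
  ![distDerivEps ε 0 (fun x => m x 0 + h x 0) + distDerivEps ε 1 (fun x => m x 1 + h x 1)
      + distDerivEps ε 2 (fun x => m x 2 + h x 2),
    distDerivEps ε 1 (fun x => h x 2) - distDerivEps ε 2 (fun x => h x 1),
    distDerivEps ε 2 (fun x => h x 0) - distDerivEps ε 0 (fun x => h x 2),
    distDerivEps ε 0 (fun x => h x 1) - distDerivEps ε 1 (fun x => h x 0)]

/-- The limit operator `(∂₃ (m₃ + h₃), - ∂₃ h₂, ∂₃ h₁, ∂₁ h₂ - ∂₂ h₁)`. -/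
def A0 (m h : E3 → E3) : Fin 4 → 𝓓((⊤ : Opens E3), ℝ) → ℝ :=
  ![distDeriv 2 (fun x => m x 2 + h x 2),
    - distDeriv 2 (fun x => h x 1),
    distDeriv 2 (fun x => h x 0),
    distDeriv 0 (fun x => h x 1) - distDeriv 1 (fun x => h x 0)]

/-! ### Admissible fields and energies -/

/-- `Ω₁ = ω × (0, 1)`. -/
def film (ω : Opens E2) : Opens E3 where
  carrier := {x | !₂[x 0, x 1] ∈ ω ∧ 0 < x 2 ∧ x 2 < 1}
  is_open' := by
    have h : Continuous fun x : E3 => (!₂[x 0, x 1] : E2) := by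
      refine (PiLp.continuous_toLp 2 _).comp (continuous_pi fun i => ?_)
      fin_cases i <;> simp <;> fun_prop
    have h2 : Continuous fun x : E3 => x 2 := by fun_prop
    exact (ω.isOpen.preimage h).inter
      ((isOpen_lt continuous_const h2).inter (isOpen_lt h2 continuous_const))

/-- `W^{1,2}(Ω₁; ℝ³) × L²(ℝ³; ℝ³)`. -/
abbrev State (ω : Opens E2) : Type := W12 (film ω) × L2Space

/-- `|m| = m_s` almost everywhere in `Ω₁`. -/
def Saturated {ω : Opens E2} (ms : ℝ) (m : W12 (film ω)) : Prop :=
  ∀ᵐ x ∂(volume.restrict (film ω : Set E3)), ‖field m x‖ = ms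

/-- The set `𝒰_ε` of admissible pairs `(m, h)`. -/
def Ueps (ω : Opens E2) (ms ε : ℝ) : Set (State ω) :=
  {p | Aeps ε (zeroExt p.1) p.2 = 0 ∧ Saturated ms p.1}

/-- The set `𝒰_0` of admissible pairs of the limit problem. -/
def U0 (ω : Opens E2) (ms : ℝ) : Set (State ω) :=
  {p | A0 (zeroExt p.1) p.2 = 0 ∧ weakDeriv 2 p.1 = 0 ∧ Saturated ms p.1}

open Classical in
/-- The rescaled energy `F_ε`, with `|∇_ε m|² = |∂₁m|² + |∂₂m|² + |ε⁻¹ ∂₃m|²`. -/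
def Feps (ω : Opens E2) (α ms : ℝ) (φ : E3 → ℝ) (ε : ℝ) (p : State ω) : ℝ≥0∞ :=
  if p ∈ Ueps ω ms ε then
    (∫⁻ x in (film ω : Set E3), ENNReal.ofReal
      (α * (‖weakDeriv 0 p.1 x‖ ^ 2 + ‖weakDeriv 1 p.1 x‖ ^ 2 + ‖ε⁻¹ • weakDeriv 2 p.1 x‖ ^ 2) + φ (field p.1 x)))
    + ∫⁻ x, ENNReal.ofReal (1 / 2 * ‖p.2 x‖ ^ 2)
  else ⊤

open Classical in
/-- The limit energy `F_0`, with `|∇'m|² = |∂₁m|² + |∂₂m|²`. -/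
def F0 (ω : Opens E2) (α ms : ℝ) (φ : E3 → ℝ) (p : State ω) : ℝ≥0∞ :=
  if p ∈ U0 ω ms then
    (∫⁻ x in (film ω : Set E3), ENNReal.ofReal
      (α * (‖weakDeriv 0 p.1 x‖ ^ 2 + ‖weakDeriv 1 p.1 x‖ ^ 2) + φ (field p.1 x)))
    + ∫⁻ x, ENNReal.ofReal (1 / 2 * ‖p.2 x‖ ^ 2)
  else ⊤

/-! ### Weak convergence and Γ-convergence -/

section Gamma

variable {X : Type*} [NormedAddCommGroup X] [NormedSpace ℝ X]

/-- `u_j ⇀ x`: convergence in the weak topology of the normed space `X`. -/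
def WeaklyTendsto (u : ℕ → X) (x : X) : Prop :=
  Tendsto (fun j => toWeakSpace ℝ X (u j)) atTop (𝓝 (toWeakSpace ℝ X x))

/-- `ε_j → 0⁺`. -/
def ToZeroPlus (ε : ℕ → ℝ) : Prop :=
  (∀ j, 0 < ε j) ∧ Tendsto ε atTop (𝓝 0)

/-- `G` is the Γ-limit of `(F_ε)` as `ε → 0⁺` with respect to weak convergence: along every
sequence `ε_j → 0⁺` the liminf inequality holds and every point has a recovery sequence. -/
def IsWeakGammaLimit (F : ℝ → X → ℝ≥0∞) (G : X → ℝ≥0∞) : Prop :=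
  ∀ ε : ℕ → ℝ, ToZeroPlus ε →
    (∀ (x : X) (u : ℕ → X), WeaklyTendsto u x →
      G x ≤ liminf (fun j => F (ε j) (u j)) atTop) ∧
    (∀ x : X, ∃ u : ℕ → X, WeaklyTendsto u x ∧
      limsup (fun j => F (ε j) (u j)) atTop ≤ G x)

end Gamma

end ThinFilm

end

/-! The stray field decouples from the exchange energy in the thin-film limit, and this is the whole
mechanism.

*Limit constraint.* Multiplying `div_ε (m + h) = 0` and the first two components of `curl_ε h = 0`
by `ε` leaves `∂₃ (m₃ + h₃) = 0`, `∂₃ h₂ = 0`, `∂₃ h₁ = 0` in the limit, along weakly convergent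
sequences (`A0_eq_zero_of_weaklyTendsto`). A square-integrable function on the whole space with
vanishing derivative in one direction is zero (`ae_eq_zero_of_integral_mul_fderiv_eq_zero`), so the
limit constraint means `h = -m₃ e₃` (`ae_of_A0_eq_zero`). In particular `m` determines `h`.

*Recovery sequence.* For an admissible limit pair `(m, h)` the magnetisation is kept and `h_ε` is
minus the orthogonal projection of `m` on the closure of the rescaled gradients of test functions
(`exists_strayField`). Then `m + h_ε` is orthogonal to gradients, `h_ε` is orthogonal to curls, and
`‖h_ε‖² = -⟨m, h_ε⟩`. The `h_ε` are bounded, every weak limit satisfies the limit constraint and is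
therefore `h`, and `‖h_ε‖² → -⟨m, h⟩ = ‖h‖²` (`exists_strayField_tendsto`). No Fourier transform
is needed.

*Lower bound and compactness.* Bounded energy bounds the fields in the Hilbert space and forces
`∂₃ m_ε → 0` (`exists_bounds_of_Feps_le`). The quadratic terms are weakly lower semicontinuous. The
constraint `|m| = m_s` and the anisotropy term need convergence almost everywhere along a
subsequence; it comes from Rellich's theorem, in the form of convergence in `L¹` on an arbitrary
open set of finite measure (`tendsto_lintegral_enorm_field`). That is proved with cutoffs: on the
whole space a derivative bound controls the `L²` modulus of continuity by duality
(`eLpNorm_translate_sub_le`), hence the distance to averages over small balls, and these averages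
converge by dominated convergence. The three facts are combined in `mem_U0_and_F0_le`, which gives
both the liminf inequality and the admissibility of weak limits. -/

noncomputable section

namespace ThinFilm

/-! ### Weak convergence -/

section WeakConvergence

variable {X Y : Type*} [NormedAddCommGroup X] [NormedSpace ℝ X] [NormedAddCommGroup Y]
  [NormedSpace ℝ Y]

theorem weaklyTendsto_iff {u : ℕ → X} {x : X} :
    WeaklyTendsto u x ↔ ∀ f : X →L[ℝ] ℝ, Tendsto (fun j => f (u j)) atTop (𝓝 (f x)) := by
  have hinj : Function.Injective (topDualPairing ℝ X).flip := by
    intro a b hab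
    refine (SeparatingDual.eq_iff_forall_dual_eq (R := ℝ)).2 fun g => ?_
    exact DFunLike.congr_fun hab g
  exact WeakBilin.tendsto_iff_forall_eval_tendsto _ hinj

theorem WeaklyTendsto.map {u : ℕ → X} {x : X} (h : WeaklyTendsto u x) (L : X →L[ℝ] Y) :
    WeaklyTendsto (fun j => L (u j)) (L x) :=
  weaklyTendsto_iff.2 fun f => weaklyTendsto_iff.1 h (f.comp L)

theorem WeaklyTendsto.comp_strictMono {u : ℕ → X} {x : X} (h : WeaklyTendsto u x) {k : ℕ → ℕ}
    (hk : StrictMono k) : WeaklyTendsto (u ∘ k) x :=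
  weaklyTendsto_iff.2 fun f => (weaklyTendsto_iff.1 h f).comp hk.tendsto_atTop

theorem WeaklyTendsto.prodMk {u : ℕ → X} {x : X} {v : ℕ → Y} {y : Y} (hu : WeaklyTendsto u x)
    (hv : WeaklyTendsto v y) : WeaklyTendsto (fun j => (u j, v j)) (x, y) := by
  refine weaklyTendsto_iff.2 fun f => ?_
  have h := (weaklyTendsto_iff.1 hu (f.comp (.inl ℝ X Y))).add
    (weaklyTendsto_iff.1 hv (f.comp (.inr ℝ X Y)))
  have e : ∀ (a : X) (b : Y), f.comp (.inl ℝ X Y) a + f.comp (.inr ℝ X Y) b = f (a, b) := by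
    intro a b
    simp [← map_add]
  simpa only [e] using h

theorem weaklyTendsto_const (x : X) : WeaklyTendsto (fun _ => x) x := tendsto_const_nhds

end WeakConvergence

/-! ### Weak compactness in Hilbert spaces -/

section Hilbert

variable {H : Type*} [NormedAddCommGroup H] [InnerProductSpace ℝ H]

theorem WeaklyTendsto.inner_right {u : ℕ → H} {x : H} (h : WeaklyTendsto u x) (y : H) :
    Tendsto (fun j => inner ℝ y (u j)) atTop (𝓝 (inner ℝ y x)) :=
  weaklyTendsto_iff.1 h (innerSL ℝ y)

theorem weaklyTendsto_of_inner [CompleteSpace H] {u : ℕ → H} {x : H}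
    (h : ∀ y, Tendsto (fun j => inner ℝ y (u j)) atTop (𝓝 (inner ℝ y x))) :
    WeaklyTendsto u x := by
  refine weaklyTendsto_iff.2 fun f => ?_
  have := h ((InnerProductSpace.toDual ℝ H).symm f)
  simpa only [InnerProductSpace.toDual_symm_apply] using this

/-- Bounded sequences of a separable Hilbert space have weakly convergent subsequences. -/
theorem exists_weaklyTendsto_subseq [CompleteSpace H] [SeparableSpace H] {u : ℕ → H} {M : ℝ}
    (hu : ∀ j, ‖u j‖ ≤ M) : ∃ (k : ℕ → ℕ) (x : H), StrictMono k ∧ WeaklyTendsto (u ∘ k) x := by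
  have hc := WeakDual.isSeqCompact_closedBall ℝ H (0 : StrongDual ℝ H) M
  let v : ℕ → WeakDual ℝ H := fun j =>
    WeakDual.toStrongDual.symm (InnerProductSpace.toDual ℝ H (u j))
  have hv : ∀ j, v j ∈ WeakDual.toStrongDual ⁻¹' Metric.closedBall (0 : StrongDual ℝ H) M := by
    intro j
    simpa [v] using hu j
  -- Banach–Alaoglu in the dual, transported by the Riesz isometry
  obtain ⟨y, -, k, hk, hy⟩ := hc hv
  refine ⟨k, (InnerProductSpace.toDual ℝ H).symm (WeakDual.toStrongDual y), hk,
    weaklyTendsto_of_inner fun z => ?_⟩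
  have h1 := ((WeakDual.eval_continuous z).tendsto y).comp hy
  rw [real_inner_comm, InnerProductSpace.toDual_symm_apply]
  refine h1.congr fun j => ?_
  change (InnerProductSpace.toDual ℝ H (u (k j))) z = _
  rw [InnerProductSpace.toDual_apply_apply, real_inner_comm]
  rfl

/-- A functional bound against a dense set bounds the norm. -/
theorem norm_le_of_dense {S : Set H} (hS : Dense S) {x : H} {B : ℝ} (hB : 0 ≤ B)
    (h : ∀ y ∈ S, |inner ℝ x y| ≤ B * ‖y‖) : ‖x‖ ≤ B := by
  have h2 : ∀ y, |inner ℝ x y| ≤ B * ‖y‖ := by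
    intro y
    have hcl : IsClosed {y : H | |inner ℝ x y| ≤ B * ‖y‖} :=
      isClosed_le (by fun_prop) (by fun_prop)
    have := hcl.closure_subset_iff.2 (show S ⊆ _ from h)
    exact this (hS y)
  have h3 := h2 x
  rw [real_inner_self_eq_norm_sq, abs_of_nonneg (sq_nonneg _), sq] at h3
  rcases (norm_nonneg x).eq_or_lt with h0 | h0
  · exact h0 ▸ hB
  · exact le_of_mul_le_mul_right h3 h0

end Hilbert

/-! ### Distributional derivatives and translations -/

section Translation

theorem abs_integral_mul_le {α : Type*} [MeasurableSpace α] {μ : Measure α} {f g : α → ℝ}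
    (hf : MemLp f 2 μ) (hg : MemLp g 2 μ) :
    |∫ x, f x * g x ∂μ| ≤ (eLpNorm f 2 μ).toReal * (eLpNorm g 2 μ).toReal := by
  have h := abs_real_inner_le_norm (hg.toLp g) (hf.toLp f)
  rw [L2.inner_def, Lp.norm_toLp, Lp.norm_toLp, mul_comm] at h
  refine le_trans (le_of_eq (congrArg _ (integral_congr_ae ?_))) h
  filter_upwards [hf.coeFn_toLp, hg.coeFn_toLp] with x h1 h2
  rw [h1, h2]
  rfl

/-- Test functions on the whole space. -/
abbrev Test : Type := 𝓓((⊤ : Opens E3), ℝ)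

/-- A smooth compactly supported function, as a test function. -/
def Test.mk (f : E3 → ℝ) (h1 : ContDiff ℝ (⊤ : ℕ∞) f) (h2 : HasCompactSupport f) : Test :=
  ⟨f, h1, h2, fun _ _ => trivial⟩

/-- The translate `x ↦ ψ (x + z)`. -/
def Test.translate (ψ : Test) (z : E3) : Test :=
  Test.mk (fun x => ψ (x + z)) (ψ.contDiff.comp (contDiff_id.add contDiff_const))
    (ψ.hasCompactSupport.comp_homeomorph (Homeomorph.addRight z))

theorem Test.translate_apply (ψ : Test) (z x : E3) : ψ.translate z x = ψ (x + z) := rfl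

theorem Test.memLp (ψ : Test) (μ : Measure E3) [IsFiniteMeasureOnCompacts μ] : MemLp ψ 2 μ :=
  ψ.continuous.memLp_of_hasCompactSupport ψ.hasCompactSupport

theorem Test.fderiv_translate (ψ : Test) (z x : E3) :
    fderiv ℝ (ψ.translate z) x = fderiv ℝ ψ (x + z) :=
  fderiv_comp_add_right z

theorem Test.continuous_fderiv (ψ : Test) : Continuous (fderiv ℝ ψ) :=
  ψ.contDiff.continuous_fderiv (by simp)

theorem Test.eLpNorm_translate (ψ : Test) (z : E3) :
    eLpNorm (ψ.translate z) 2 volume = eLpNorm ψ 2 volume :=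
  eLpNorm_comp_measurePreserving (ψ.memLp volume).aestronglyMeasurable
    (measurePreserving_add_right volume z)

theorem Test.memLp_fderiv (ψ : Test) (v : E3) (μ : Measure E3) [IsFiniteMeasureOnCompacts μ] :
    MemLp (fun x => fderiv ℝ ψ x v) 2 μ :=
  (ψ.continuous_fderiv.clm_apply continuous_const).memLp_of_hasCompactSupport
    (ψ.hasCompactSupport.fderiv_apply (𝕜 := ℝ) v)

theorem Test.memLp_partialDeriv (ψ : Test) (i : Fin 3) (μ : Measure E3)
    [IsFiniteMeasureOnCompacts μ] : MemLp (partialDeriv i ψ) 2 μ :=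
  ψ.memLp_fderiv _ μ

/-- Differentiation under the integral sign; the derivatives of the translates near `t` are
dominated by a constant on one large ball. -/
theorem hasDerivAt_integral_mul_translate {V : E3 → ℝ} (hV : MemLp V 2 volume) (ψ : Test)
    (z : E3) (t : ℝ) :
    HasDerivAt (fun s : ℝ => ∫ x, V x * ψ (x + s • z))
      (∫ x, V x * fderiv ℝ ψ (x + t • z) z) t := by
  obtain ⟨R, hR⟩ := ψ.hasCompactSupport.isCompact.isBounded.subset_closedBall (0 : E3)
  obtain ⟨C, hC⟩ := ψ.continuous_fderiv.bounded_above_of_compact_support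
    (ψ.hasCompactSupport.fderiv (𝕜 := ℝ))
  have hC0 : 0 ≤ C := (norm_nonneg _).trans (hC 0)
  let B : Set E3 := Metric.closedBall 0 (R + (|t| + 1) * ‖z‖)
  have hB : MemLp (B.indicator fun _ => C * ‖z‖) 2 (volume : Measure E3) :=
    memLp_indicator_const 2 measurableSet_closedBall _ (Or.inr measure_closedBall_lt_top.ne)
  have key := hasDerivAt_integral_of_dominated_loc_of_deriv_le (μ := (volume : Measure E3))
    (F := fun (s : ℝ) x => V x * ψ (x + s • z))
    (F' := fun (s : ℝ) x => V x * fderiv ℝ ψ (x + s • z) z)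
    (bound := fun x => ‖V x‖ * (B.indicator fun _ => C * ‖z‖) x)
    (s := Metric.ball t 1) (x₀ := t) (Metric.ball_mem_nhds t one_pos) ?_ ?_ ?_ ?_ ?_ ?_
  · exact key.2
  · exact Eventually.of_forall fun s => hV.aestronglyMeasurable.mul
      ((ψ.translate (s • z)).memLp volume).aestronglyMeasurable
  · exact hV.integrable_mul ((ψ.translate (t • z)).memLp volume)
  · refine hV.aestronglyMeasurable.mul (Continuous.aestronglyMeasurable ?_)
    exact (ψ.continuous_fderiv.comp (continuous_id.add continuous_const)).clm_apply
      continuous_const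
  · refine Eventually.of_forall fun x s hs => ?_
    rw [norm_mul]
    refine mul_le_mul_of_nonneg_left ?_ (norm_nonneg _)
    by_cases hx : x ∈ B
    · rw [Set.indicator_of_mem hx]
      exact (ContinuousLinearMap.le_opNorm _ _).trans
        (mul_le_mul_of_nonneg_right (hC _) (norm_nonneg _))
    · rw [Set.indicator_of_notMem hx]
      have hz : x + s • z ∉ tsupport (fderiv ℝ ψ) := by
        intro hmem
        have h1 := hR (tsupport_fderiv_subset ℝ hmem)
        refine hx ?_
        rw [mem_closedBall_zero_iff] at h1 ⊢
        have h2 : ‖x‖ ≤ ‖x + s • z‖ + ‖s • z‖ := by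
          simpa using norm_sub_le (x + s • z) (s • z)
        have h3 : |s| ≤ |t| + 1 := by
          have := abs_sub_abs_le_abs_sub s t
          have h4 : |s - t| < 1 := hs
          linarith
        rw [norm_smul, Real.norm_eq_abs] at h2
        nlinarith [mul_le_mul_of_nonneg_right h3 (norm_nonneg z)]
      rw [image_eq_zero_of_notMem_tsupport hz]
      simp
  · exact hV.norm.integrable_mul hB
  · refine Eventually.of_forall fun x s _ => ?_
    have h1 : HasDerivAt (fun s : ℝ => x + s • z) z s := by
      simpa using ((hasDerivAt_id s).smul_const z).const_add x
    have h2 : HasFDerivAt ψ (fderiv ℝ ψ (x + s • z)) (x + s • z) :=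
      (ψ.contDiff.differentiable (by simp) _).hasFDerivAt
    exact (h2.comp_hasDerivAt s h1).const_mul (V x)

/-- A bound on the distributional derivative of `V` in direction `z` bounds the difference of `V`
and its translate by `z`, tested against `ψ`. -/
theorem abs_integral_mul_translate_sub_le {V : E3 → ℝ} (hV : MemLp V 2 volume) {z : E3} {A : ℝ}
    (hA : ∀ ψ : Test, |∫ x, V x * fderiv ℝ ψ x z| ≤ A * (eLpNorm ψ 2 volume).toReal) (ψ : Test) :
    |(∫ x, V x * ψ (x + z)) - ∫ x, V x * ψ x| ≤ A * (eLpNorm ψ 2 volume).toReal := by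
  have h := norm_image_sub_le_of_norm_deriv_le_segment_01'
    (f := fun s : ℝ => ∫ x, V x * ψ (x + s • z))
    (fun s _ => (hasDerivAt_integral_mul_translate hV ψ z s).hasDerivWithinAt)
    (C := A * (eLpNorm ψ 2 volume).toReal) ?_
  · simpa using h
  · intro s _
    have := hA (ψ.translate (s • z))
    rw [ψ.eLpNorm_translate] at this
    rw [Real.norm_eq_abs]
    simpa only [Test.fderiv_translate] using this

/-- An `L²` function on the whole space whose distributional derivative in one direction vanishes
is zero: it is invariant under translations in that direction, so it pairs with a test function as
with its translate to infinity. -/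
theorem ae_eq_zero_of_integral_mul_fderiv_eq_zero {V : E3 → ℝ} (hV : MemLp V 2 volume) {z : E3}
    (hz : z ≠ 0) (h : ∀ ψ : Test, ∫ x, V x * fderiv ℝ ψ x z = 0) : V =ᵐ[volume] 0 := by
  refine ae_eq_zero_of_integral_contDiff_smul_eq_zero (hV.locallyIntegrable (by norm_num))
    fun g hg hgs => ?_
  set ψ : Test := Test.mk g hg hgs with hψ
  have inv : ∀ t : ℝ, ∫ x, V x * ψ (x + t • z) = ∫ x, V x * ψ x := by
    intro t
    have := abs_integral_mul_translate_sub_le hV (z := t • z) (A := 0) (fun η => by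
      simp [mul_left_comm, integral_const_mul, h η]) ψ
    rw [zero_mul] at this
    exact sub_eq_zero.1 (abs_nonpos_iff.1 this)
  have small : ∀ ε : ℝ, 0 < ε → |∫ x, V x * ψ x| ≤ ε * (eLpNorm ψ 2 volume).toReal := by
    intro ε hε
    -- `f` is compactly supported and close to `V`; a far translate of `ψ` does not meet it
    obtain ⟨f, hf1, hf2, hf3⟩ := hV.exist_eLpNorm_sub_le (by simp) (by norm_num) hε
    have hf : MemLp f 2 volume := hf2.continuous.memLp_of_hasCompactSupport hf1
    obtain ⟨R, hR⟩ := hf1.isCompact.isBounded.subset_closedBall (0 : E3)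
    obtain ⟨S, hS⟩ := ψ.hasCompactSupport.isCompact.isBounded.subset_closedBall (0 : E3)
    obtain ⟨t, ht⟩ : ∃ t : ℝ, R + S < t * ‖z‖ ∧ 0 ≤ t := by
      refine ⟨(|R + S| + 1) / ‖z‖, ?_, by positivity⟩
      rw [div_mul_cancel₀ _ (norm_ne_zero_iff.2 hz)]
      linarith [le_abs_self (R + S)]
    have hdis : ∀ x, f x * ψ (x + t • z) = 0 := by
      intro x
      by_contra hne
      have h1 := hR (subset_tsupport _ (left_ne_zero_of_mul hne))
      have h2 := hS (subset_tsupport _ (right_ne_zero_of_mul hne))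
      rw [mem_closedBall_zero_iff] at h1 h2
      have h3 : ‖t • z‖ ≤ ‖x + t • z‖ + ‖x‖ := by simpa using norm_sub_le (x + t • z) x
      rw [norm_smul, Real.norm_eq_abs, abs_of_nonneg ht.2] at h3
      linarith [ht.1]
    have e : ∫ x, V x * ψ x = ∫ x, (V - f) x * ψ.translate (t • z) x := by
      rw [← inv t]
      refine integral_congr_ae (Eventually.of_forall fun x => ?_)
      simp [Test.translate_apply, sub_mul, hdis]
    rw [e]
    refine (abs_integral_mul_le (hV.sub hf) ((ψ.translate (t • z)).memLp volume)).trans ?_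
    rw [ψ.eLpNorm_translate]
    exact mul_le_mul_of_nonneg_right (ENNReal.toReal_le_of_le_ofReal hε.le hf3)
      ENNReal.toReal_nonneg
  have : |∫ x, V x * ψ x| ≤ 0 := by
    have hlim : Tendsto (fun ε : ℝ => ε * (eLpNorm ψ 2 volume).toReal) (𝓝[>] 0) (𝓝 0) := by
      have : Tendsto (fun ε : ℝ => ε * (eLpNorm ψ 2 volume).toReal) (𝓝 0)
        (𝓝 (0 * (eLpNorm ψ 2 volume).toReal)) := tendsto_id.mul_const _
      rw [zero_mul] at this
      exact this.mono_left nhdsWithin_le_nhds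
    exact ge_of_tendsto hlim (eventually_nhdsWithin_of_forall fun ε hε => small ε hε)
  have h0 := abs_nonpos_iff.1 this
  rw [← h0]
  exact integral_congr_ae (Eventually.of_forall fun x => mul_comm _ _)

/-- A bound on the distributional derivatives of `V` bounds its `L²` modulus of continuity. -/
theorem eLpNorm_translate_sub_le {V : E3 → ℝ} (hV : MemLp V 2 volume) {z : E3} {A : ℝ}
    (hA0 : 0 ≤ A)
    (hA : ∀ ψ : Test, |∫ x, V x * fderiv ℝ ψ x z| ≤ A * (eLpNorm ψ 2 volume).toReal) :
    eLpNorm (fun x => V (x - z) - V x) 2 volume ≤ ENNReal.ofReal A := by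
  have hVz : MemLp (fun x => V (x - z)) 2 volume :=
    hV.comp_measurePreserving (measurePreserving_sub_right volume z)
  have hD := hVz.sub hV
  have key : ‖hD.toLp _‖ ≤ A := by
    refine norm_le_of_dense (Lp.dense_hasCompactSupport_contDiff (E := E3) (F := ℝ) (p := 2)
      (μ := volume) (by simp)) hA0 ?_
    rintro y ⟨g, hyg, hg1, hg2⟩
    set ψ : Test := Test.mk g hg2 hg1
    have e1 : ‖y‖ = (eLpNorm ψ 2 volume).toReal := by
      rw [Lp.norm_def, eLpNorm_congr_ae hyg]; rfl
    have e2 : inner ℝ (hD.toLp _) y = (∫ x, V x * ψ (x + z)) - ∫ x, V x * ψ x := by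
      rw [L2.inner_def]
      have e3 : ∫ x, V x * ψ (x + z) = ∫ x, V (x - z) * ψ x := by
        rw [← integral_sub_right_eq_self (fun x => V x * ψ (x + z)) z]
        simp
      rw [e3]
      refine Eq.trans (integral_congr_ae ?_) (integral_sub (hVz.integrable_mul (ψ.memLp volume))
        (hV.integrable_mul (ψ.memLp volume)))
      filter_upwards [hD.coeFn_toLp, hyg] with x h1 h2
      rw [h1, h2]
      simp only [RCLike.inner_apply, conj_trivial, Pi.sub_apply]
      rw [mul_comm, sub_mul]
      rfl
    rw [e1, e2]
    exact abs_integral_mul_translate_sub_le hV hA ψ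
  rw [Lp.norm_toLp] at key
  exact (ENNReal.le_ofReal_iff_toReal_le hD.eLpNorm_ne_top hA0).2 key

end Translation

/-! ### Rellich's theorem on the whole space -/

section Compactness

/-- The integral of `V` over the ball of radius `δ` around `x`: the mean of `V` there, without the
normalising factor. -/
def ballIntegral (δ : ℝ) (V : E3 → ℝ) (x : E3) : ℝ := ∫ z in Metric.ball (0 : E3) δ, V (x - z)

theorem measurable_translate_uncurry {V : E3 → ℝ} (hV : Measurable V) :
    Measurable (fun p : E3 × E3 => V (p.1 - p.2)) :=
  hV.comp (measurable_fst.sub measurable_snd)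

theorem stronglyMeasurable_ballIntegral {V : E3 → ℝ} (hV : Measurable V) (δ : ℝ) :
    StronglyMeasurable (ballIntegral δ V) :=
  StronglyMeasurable.integral_prod_right
    (f := fun x z => V (x - z)) (measurable_translate_uncurry hV).stronglyMeasurable

theorem ballIntegral_eq {V : E3 → ℝ} (δ : ℝ) (x : E3) :
    ballIntegral δ V x = ∫ y, V y * (Metric.ball x δ).indicator (fun _ => (1 : ℝ)) y := by
  rw [ballIntegral, ← integral_indicator measurableSet_ball,
    ← integral_sub_left_eq_self (fun y => V y * _) volume x]
  refine integral_congr_ae (Eventually.of_forall fun z => ?_)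
  by_cases hz : z ∈ Metric.ball (0 : E3) δ
  · have : x - z ∈ Metric.ball x δ := by simpa [mem_ball_iff_norm] using hz
    simp [Set.indicator_of_mem hz, Set.indicator_of_mem this]
  · have : x - z ∉ Metric.ball x δ := by simpa [mem_ball_iff_norm] using hz
    simp [Set.indicator_of_notMem hz, Set.indicator_of_notMem this]

theorem memLp_indicator_ball (x : E3) (δ : ℝ) :
    MemLp ((Metric.ball x δ).indicator (fun _ => (1 : ℝ))) 2 (volume : Measure E3) :=
  memLp_indicator_const 2 measurableSet_ball _ (Or.inr measure_ball_lt_top.ne)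

theorem abs_ballIntegral_le {V : E3 → ℝ} (hV : MemLp V 2 volume) (δ : ℝ) (x : E3) :
    |ballIntegral δ V x| ≤ (eLpNorm V 2 volume).toReal *
      (eLpNorm ((Metric.ball (0 : E3) δ).indicator (fun _ => (1 : ℝ))) 2 volume).toReal := by
  rw [ballIntegral_eq]
  refine (abs_integral_mul_le hV (memLp_indicator_ball x δ)).trans_eq ?_
  rw [eLpNorm_indicator_const measurableSet_ball (by simp) (by simp),
    eLpNorm_indicator_const measurableSet_ball (by simp) (by simp),
    Measure.addHaar_ball_center volume x]

theorem sub_notMem_of_notMem_cthickening {K : Set E3} {δ : ℝ} (hδ : δ ≤ 1) {x z : E3}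
    (hz : z ∈ Metric.ball (0 : E3) δ) (hx : x ∉ Metric.cthickening 1 K) : x - z ∉ K := by
  intro hmem
  refine hx (Metric.mem_cthickening_of_dist_le x (x - z) 1 K hmem ?_)
  rw [mem_ball_zero_iff] at hz
  rw [dist_eq_norm, sub_sub_cancel]
  linarith

theorem notMem_of_notMem_cthickening {K : Set E3} {x : E3}
    (hx : x ∉ Metric.cthickening 1 K) : x ∉ K := fun h =>
  hx (Metric.self_subset_cthickening K h)

/-- The distance in `L¹` of a function to its ball averages, bounded by the derivatives. Both sides
are multiplied by the volume of the ball. -/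
theorem lintegral_mul_enorm_le {V : E3 → ℝ} (hm : Measurable V) (hV : MemLp V 2 volume)
    {K : Set E3} (hK : ∀ x ∉ K, V x = 0) {A : ℝ} (hA0 : 0 ≤ A)
    (hA : ∀ (z : E3) (ψ : Test),
      |∫ x, V x * fderiv ℝ ψ x z| ≤ A * ‖z‖ * (eLpNorm ψ 2 volume).toReal)
    {δ : ℝ} (hδ : δ ≤ 1) :
    volume (Metric.ball (0 : E3) δ) * ∫⁻ x, ‖V x‖ₑ ≤
      volume (Metric.ball (0 : E3) δ) *
        (ENNReal.ofReal (A * δ) * volume (Metric.cthickening 1 K) ^ ((1 : ℝ) / 2))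
      + ∫⁻ x, ‖ballIntegral δ V x‖ₑ := by
  set B := Metric.ball (0 : E3) δ with hB
  have hfin : IsFiniteMeasure ((volume : Measure E3).restrict B) :=
    ⟨by rw [Measure.restrict_apply_univ]; exact measure_ball_lt_top⟩
  have hmeas : Measurable (fun p : E3 × E3 => ‖V (p.1 - p.2) - V p.1‖ₑ) :=
    ((measurable_translate_uncurry hm).sub (hm.comp measurable_fst)).enorm
  have pt : ∀ x, volume B * ‖V x‖ₑ ≤
      (∫⁻ z in B, ‖V (x - z) - V x‖ₑ) + ‖ballIntegral δ V x‖ₑ := by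
    intro x
    have hI : Integrable (fun z => V (x - z)) (volume.restrict B) := by
      have h1 : MemLp (fun z => V (x - z)) 2 volume :=
        hV.comp_measurePreserving (Measure.measurePreserving_sub_left volume x)
      exact (h1.restrict B).integrable (by norm_num)
    have e1 : volume B * ‖V x‖ₑ = ‖∫ _ in B, V x‖ₑ := by
      rw [setIntegral_const, enorm_smul, Measure.real, Real.enorm_of_nonneg ENNReal.toReal_nonneg,
        ENNReal.ofReal_toReal measure_ball_lt_top.ne]
    have e2 : ∫ _ in B, V x = ballIntegral δ V x - ∫ z in B, (V (x - z) - V x) := by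
      rw [integral_sub hI (integrable_const _), ballIntegral, sub_sub_cancel]
    rw [e1, e2, add_comm]
    exact (enorm_sub_le).trans (add_le_add_right (enorm_integral_le_lintegral_enorm _) _)
  have shift : ∀ z ∈ B, ∫⁻ x, ‖V (x - z) - V x‖ₑ ≤
      ENNReal.ofReal (A * δ) * volume (Metric.cthickening 1 K) ^ ((1 : ℝ) / 2) := by
    intro z hz
    have hz' : ‖z‖ ≤ δ := (mem_ball_zero_iff.1 hz).le
    set D : E3 → ℝ := fun x => V (x - z) - V x with hD
    have hDm : Measurable D := (hm.comp (measurable_id.sub_const z)).sub hm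
    have h0 : ∀ x ∉ Metric.cthickening 1 K, ‖D x‖ₑ = 0 := by
      intro x hx
      simp [hD, hK _ (sub_notMem_of_notMem_cthickening hδ hz hx),
        hK _ (notMem_of_notMem_cthickening hx)]
    have h1 : ∫⁻ x, ‖D x‖ₑ = eLpNorm D 1 (volume.restrict (Metric.cthickening 1 K)) := by
      rw [eLpNorm_one_eq_lintegral_enorm, setLIntegral_eq_of_support_subset]
      intro x hx
      by_contra hx'
      exact hx (h0 x hx')
    have h2 := eLpNorm_le_eLpNorm_mul_rpow_measure_univ (μ := volume.restrict
      (Metric.cthickening 1 K)) (f := D) (p := 1) (q := 2) (by norm_num) hDm.aestronglyMeasurable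
    rw [Measure.restrict_apply_univ] at h2
    rw [h1]
    refine h2.trans ?_
    have e : (1 / (1 : ℝ≥0∞).toReal - 1 / (2 : ℝ≥0∞).toReal) = (1 : ℝ) / 2 := by norm_num
    rw [e]
    gcongr
    refine (eLpNorm_mono_measure _ Measure.restrict_le_self).trans ?_
    refine (eLpNorm_translate_sub_le hV (by positivity) (hA z)).trans ?_
    exact ENNReal.ofReal_le_ofReal (mul_le_mul_of_nonneg_left hz' hA0)
  calc volume B * ∫⁻ x, ‖V x‖ₑ = ∫⁻ x, volume B * ‖V x‖ₑ :=
        (lintegral_const_mul _ hm.enorm).symm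
    _ ≤ ∫⁻ x, ((∫⁻ z in B, ‖V (x - z) - V x‖ₑ) + ‖ballIntegral δ V x‖ₑ) := lintegral_mono pt
    _ = (∫⁻ x, ∫⁻ z in B, ‖V (x - z) - V x‖ₑ) + ∫⁻ x, ‖ballIntegral δ V x‖ₑ :=
        lintegral_add_right _ (stronglyMeasurable_ballIntegral hm δ).measurable.enorm
    _ = (∫⁻ z in B, ∫⁻ x, ‖V (x - z) - V x‖ₑ) + ∫⁻ x, ‖ballIntegral δ V x‖ₑ := by
        rw [lintegral_lintegral_swap hmeas.aemeasurable]
    _ ≤ _ := by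
        refine add_le_add_left ?_ _
        refine (setLIntegral_mono_ae' measurableSet_ball (Eventually.of_forall shift)).trans ?_
        rw [setLIntegral_const, mul_comm]

/-- **Rellich's theorem**, for functions on the whole space with support in a fixed compact set:
a sequence bounded in `W^{1,2}` that converges weakly to zero in `L²` converges to zero in `L¹`. -/
theorem tendsto_lintegral_enorm_of_weak {V : ℕ → E3 → ℝ} (hm : ∀ j, Measurable (V j))
    (hV : ∀ j, MemLp (V j) 2 volume) {K : Set E3} (hKc : IsCompact K)
    (hK : ∀ j, ∀ x ∉ K, V j x = 0) {A : ℝ} (hA0 : 0 ≤ A)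
    (hVA : ∀ j, (eLpNorm (V j) 2 volume).toReal ≤ A)
    (hA : ∀ j (z : E3) (ψ : Test),
      |∫ x, V j x * fderiv ℝ ψ x z| ≤ A * ‖z‖ * (eLpNorm ψ 2 volume).toReal)
    (hw : ∀ a : E3 → ℝ, MemLp a 2 volume → Tendsto (fun j => ∫ x, V j x * a x) atTop (𝓝 0)) :
    Tendsto (fun j => ∫⁻ x, ‖V j x‖ₑ) atTop (𝓝 0) := by
  have hK' : IsCompact (Metric.cthickening 1 K) := hKc.cthickening
  have hc : volume (Metric.cthickening 1 K) ^ ((1 : ℝ) / 2) ≠ ∞ :=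
    ENNReal.rpow_ne_top_of_nonneg (by norm_num) hK'.measure_lt_top.ne
  -- at a fixed radius the averages converge boundedly, hence in `L¹`
  have avg : ∀ δ : ℝ, δ ≤ 1 → Tendsto (fun j => ∫⁻ x, ‖ballIntegral δ (V j) x‖ₑ) atTop (𝓝 0) := by
    intro δ hδ
    set M : ℝ := A * (eLpNorm ((Metric.ball (0 : E3) δ).indicator (fun _ => (1 : ℝ))) 2
      volume).toReal
    have := tendsto_lintegral_of_dominated_convergence (μ := (volume : Measure E3))
      (F := fun j x => ‖ballIntegral δ (V j) x‖ₑ) (f := fun _ => 0)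
      ((Metric.cthickening 1 K).indicator fun _ => ENNReal.ofReal M)
      (fun j => (stronglyMeasurable_ballIntegral (hm j) δ).measurable.enorm) ?_ ?_ ?_
    · simpa using this
    · intro j
      refine Eventually.of_forall fun x => ?_
      by_cases hx : x ∈ Metric.cthickening 1 K
      · rw [Set.indicator_of_mem hx]
        change ‖ballIntegral δ (V j) x‖ₑ ≤ _
        rw [Real.enorm_eq_ofReal_abs]
        exact ENNReal.ofReal_le_ofReal ((abs_ballIntegral_le (hV j) δ x).trans
          (mul_le_mul_of_nonneg_right (hVA j) ENNReal.toReal_nonneg))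
      · have : ballIntegral δ (V j) x = 0 :=
          setIntegral_eq_zero_of_forall_eq_zero fun z hz =>
            hK j _ (sub_notMem_of_notMem_cthickening hδ hz hx)
        simp [this]
    · rw [lintegral_indicator_const Metric.isClosed_cthickening.measurableSet]
      exact ENNReal.mul_ne_top ENNReal.ofReal_ne_top hK'.measure_lt_top.ne
    · refine Eventually.of_forall fun x => ?_
      have h1 := hw _ (memLp_indicator_ball x δ)
      simp only [← ballIntegral_eq] at h1
      have h2 := (continuous_enorm.tendsto (0 : ℝ)).comp h1
      rwa [enorm_zero] at h2
  rw [ENNReal.tendsto_nhds_zero]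
  intro ε hε
  rcases eq_or_ne ε ∞ with rfl | hε'
  · simp
  have hε2 : 0 < ε / 2 := ENNReal.half_pos hε.ne'
  obtain ⟨δ, hδ0, hδ1, hδ⟩ : ∃ δ : ℝ, 0 < δ ∧ δ ≤ 1 ∧
      ENNReal.ofReal (A * δ) * volume (Metric.cthickening 1 K) ^ ((1 : ℝ) / 2) ≤ ε / 2 := by
    have h1 : Tendsto (fun δ : ℝ => ENNReal.ofReal (A * δ) *
        volume (Metric.cthickening 1 K) ^ ((1 : ℝ) / 2)) (𝓝 0) (𝓝 0) := by
      have h2 : Tendsto (fun δ : ℝ => ENNReal.ofReal (A * δ)) (𝓝 0) (𝓝 0) := by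
        have h3 : Continuous fun δ : ℝ => ENNReal.ofReal (A * δ) :=
          ENNReal.continuous_ofReal.comp (continuous_const.mul continuous_id)
        simpa using h3.tendsto 0
      simpa using ENNReal.Tendsto.mul_const h2 (Or.inr hc)
    have h4 : ∀ᶠ δ : ℝ in 𝓝[>] 0, ENNReal.ofReal (A * δ) *
        volume (Metric.cthickening 1 K) ^ ((1 : ℝ) / 2) ≤ ε / 2 :=
      (h1.mono_left nhdsWithin_le_nhds).eventually (ge_mem_nhds hε2)
    have h5 : ∀ᶠ δ : ℝ in 𝓝[>] 0, δ ≤ 1 :=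
      nhdsWithin_le_nhds (ge_mem_nhds one_pos)
    obtain ⟨δ, ⟨h6, h7⟩, h8⟩ := ((h4.and h5).and self_mem_nhdsWithin).exists
    exact ⟨δ, h8, h7, h6⟩
  set b := volume (Metric.ball (0 : E3) δ)
  have hb0 : b ≠ 0 := (Metric.measure_ball_pos volume 0 hδ0).ne'
  have hbt : b ≠ ∞ := measure_ball_lt_top.ne
  have hpos : 0 < b * (ε / 2) := ENNReal.mul_pos hb0 hε2.ne'
  filter_upwards [ENNReal.tendsto_nhds_zero.1 (avg δ hδ1) _ hpos] with j hj
  have h := lintegral_mul_enorm_le (hm j) (hV j) (hK j) hA0 (hA j) hδ1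
  have h2 : b * ∫⁻ x, ‖V j x‖ₑ ≤ b * ε := by
    refine h.trans ((add_le_add (mul_le_mul_right hδ b) hj).trans_eq ?_)
    rw [← mul_add, ENNReal.add_halves]
  exact (ENNReal.mul_le_mul_iff_right hb0 hbt).1 h2

end Compactness

/-! ### Coordinates of square-integrable fields -/

section Coordinates

theorem abs_coord_le (v : E3) (k : Fin 3) : |v k| ≤ ‖v‖ := by
  simpa using PiLp.norm_apply_le v k

theorem eq_sum_smul_single (v : E3) : v = ∑ k, v k • (EuclideanSpace.single k 1 : E3) := by
  ext k
  fin_cases k <;> simp [Fin.sum_univ_three]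

theorem memLp_coord {μ : Measure E3} (u : Lp E3 2 μ) (k : Fin 3) : MemLp (fun x => u x k) 2 μ :=
  (EuclideanSpace.proj (𝕜 := ℝ) k : E3 →L[ℝ] ℝ).comp_memLp' (Lp.memLp u)

theorem memLp_smul_single {μ : Measure E3} {a : E3 → ℝ} (ha : MemLp a 2 μ) (k : Fin 3) :
    MemLp (fun x => a x • (EuclideanSpace.single k 1 : E3)) 2 μ :=
  (ContinuousLinearMap.toSpanSingleton ℝ (EuclideanSpace.single k 1 : E3)).comp_memLp' ha

/-- The functional `u ↦ ∫ a u_k` on `L²`. -/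
def coordPairing {μ : Measure E3} (a : E3 → ℝ) (ha : MemLp a 2 μ) (k : Fin 3) :
    Lp E3 2 μ →L[ℝ] ℝ :=
  innerSL ℝ ((memLp_smul_single ha k).toLp _)

theorem coordPairing_apply {μ : Measure E3} {a : E3 → ℝ} (ha : MemLp a 2 μ) (k : Fin 3)
    (u : Lp E3 2 μ) : coordPairing a ha k u = ∫ x, a x * u x k ∂μ := by
  rw [coordPairing, innerSL_apply_apply, L2.inner_def]
  refine integral_congr_ae ?_
  filter_upwards [(memLp_smul_single ha k).coeFn_toLp] with x hx
  rw [hx, inner_smul_left, EuclideanSpace.inner_single_left]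
  simp

theorem memLp_mul_coord {μ : Measure E3} {b : E3 → ℝ} (hb : Continuous b) {C : ℝ}
    (hC : ∀ x, ‖b x‖ ≤ C) (u : Lp E3 2 μ) (k : Fin 3) :
    MemLp (fun x => b x * u x k) 2 μ ∧
      (eLpNorm (fun x => b x * u x k) 2 μ).toReal ≤ C * ‖u‖ := by
  have hC0 : 0 ≤ C := (norm_nonneg _).trans (hC 0)
  have hle : eLpNorm (fun x => b x * u x k) 2 μ ≤ ENNReal.ofReal C * eLpNorm u 2 μ := by
    refine eLpNorm_le_mul_eLpNorm_of_ae_le_mul (Eventually.of_forall fun x => ?_) 2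
    rw [norm_mul]
    exact mul_le_mul (hC x) (abs_coord_le _ k) (norm_nonneg _) hC0
  have hfin : ENNReal.ofReal C * eLpNorm u 2 μ ≠ ∞ :=
    ENNReal.mul_ne_top ENNReal.ofReal_ne_top (Lp.eLpNorm_ne_top u)
  refine ⟨⟨hb.aestronglyMeasurable.mul (memLp_coord u k).aestronglyMeasurable,
    hle.trans_lt hfin.lt_top⟩, ?_⟩
  have := ENNReal.toReal_mono hfin hle
  rwa [ENNReal.toReal_mul, ENNReal.toReal_ofReal hC0, ← Lp.norm_def] at this

end Coordinates

/-! ### The Sobolev space as a Hilbert space -/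

section Sobolev

variable {Ω : Opens E3}

/-- `field`, as a continuous linear map. -/
def fieldL (Ω : Opens E3) : W12 Ω →L[ℝ] L2 Ω :=
  (WithLp.fstL 2 ℝ (L2 Ω) (PiLp 2 (fun _ : Fin 3 => L2 Ω))).comp (W12 Ω).subtypeL

/-- `weakDeriv i`, as a continuous linear map. -/
def weakDerivL (Ω : Opens E3) (i : Fin 3) : W12 Ω →L[ℝ] L2 Ω :=
  (PiLp.proj 2 (fun _ : Fin 3 => L2 Ω) i).comp
    ((WithLp.sndL 2 ℝ (L2 Ω) (PiLp 2 (fun _ : Fin 3 => L2 Ω))).comp (W12 Ω).subtypeL)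

theorem fieldL_apply (m : W12 Ω) : fieldL Ω m = field m := rfl

theorem weakDerivL_apply (i : Fin 3) (m : W12 Ω) : weakDerivL Ω i m = weakDeriv i m := rfl

theorem norm_sq_W12 (m : W12 Ω) :
    ‖m‖ ^ 2 = ‖field m‖ ^ 2 + (‖weakDeriv 0 m‖ ^ 2 + ‖weakDeriv 1 m‖ ^ 2 + ‖weakDeriv 2 m‖ ^ 2) := by
  change ‖(m : WithLp 2 (L2 Ω × PiLp 2 (fun _ : Fin 3 => L2 Ω)))‖ ^ 2 = _
  rw [WithLp.prod_norm_sq_eq_of_L2, PiLp.norm_sq_eq_of_L2, Fin.sum_univ_three]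
  rfl

theorem norm_field_le (m : W12 Ω) : ‖field m‖ ≤ ‖m‖ := by
  have := norm_sq_W12 m
  refine abs_le_of_sq_le_sq' ?_ (norm_nonneg _) |>.2
  nlinarith [sq_nonneg ‖weakDeriv 0 m‖, sq_nonneg ‖weakDeriv 1 m‖, sq_nonneg ‖weakDeriv 2 m‖]

theorem norm_weakDeriv_le (i : Fin 3) (m : W12 Ω) : ‖weakDeriv i m‖ ≤ ‖m‖ := by
  have := norm_sq_W12 m
  refine abs_le_of_sq_le_sq' ?_ (norm_nonneg _) |>.2
  fin_cases i <;> simp only [Fin.zero_eta, Fin.mk_one, Fin.reduceFinMk] <;>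
  nlinarith [sq_nonneg ‖field m‖, sq_nonneg ‖weakDeriv 0 m‖, sq_nonneg ‖weakDeriv 1 m‖,
    sq_nonneg ‖weakDeriv 2 m‖]

theorem coord_integral {μ : Measure E3} {f : E3 → E3} (hf : Integrable f μ) (k : Fin 3) :
    (∫ x, f x ∂μ) k = ∫ x, f x k ∂μ :=
  ((EuclideanSpace.proj (𝕜 := ℝ) k : E3 →L[ℝ] ℝ).integral_comp_comm hf).symm

theorem testFn_memLp (ψ : 𝓓(Ω, ℝ)) (μ : Measure E3) [IsFiniteMeasureOnCompacts μ] :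
    MemLp ψ 2 μ :=
  ψ.continuous.memLp_of_hasCompactSupport ψ.hasCompactSupport

theorem continuous_partialDeriv (i : Fin 3) (ψ : 𝓓(Ω, ℝ)) : Continuous (partialDeriv i ψ) :=
  (ψ.contDiff.continuous_fderiv (by simp)).clm_apply continuous_const

theorem hasCompactSupport_partialDeriv (i : Fin 3) (ψ : 𝓓(Ω, ℝ)) :
    HasCompactSupport (partialDeriv i ψ) :=
  ψ.hasCompactSupport.fderiv_apply (𝕜 := ℝ) (EuclideanSpace.single i 1)

theorem memLp_partialDeriv (i : Fin 3) (ψ : 𝓓(Ω, ℝ)) (μ : Measure E3)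
    [IsFiniteMeasureOnCompacts μ] : MemLp (partialDeriv i ψ) 2 μ :=
  (continuous_partialDeriv i ψ).memLp_of_hasCompactSupport (hasCompactSupport_partialDeriv i ψ)

/-- Weak partial derivatives, coordinate by coordinate. -/
theorem isWeakPartialDeriv_iff {i : Fin 3} {u g : L2 Ω} :
    IsWeakPartialDeriv Ω i u g ↔ ∀ (ψ : 𝓓(Ω, ℝ)) (k : Fin 3),
      ∫ x in (Ω : Set E3), partialDeriv i ψ x * u x k =
        - ∫ x in (Ω : Set E3), ψ x * g x k := by
  refine forall_congr' fun ψ => ?_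
  have h1 := coord_integral (integrable_partialDeriv_smul Ω i ψ u)
  have h2 := coord_integral (integrable_test_smul Ω ψ g)
  simp only [PiLp.smul_apply, smul_eq_mul] at h1 h2
  constructor
  · intro h k
    rw [← h1, ← h2, h]
    rfl
  · intro h
    ext k
    rw [h1, h k, ← h2]
    rfl

/-- The defining identities of weak derivatives are continuous in `L²`. -/
theorem isClosed_W12 (Ω : Opens E3) :
    IsClosed (W12 Ω : Set (WithLp 2 (L2 Ω × PiLp 2 (fun _ : Fin 3 => L2 Ω)))) := by
  have e : (W12 Ω : Set (WithLp 2 (L2 Ω × PiLp 2 (fun _ : Fin 3 => L2 Ω)))) =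
      ⋂ (i : Fin 3) (ψ : 𝓓(Ω, ℝ)) (k : Fin 3),
        {p | coordPairing (partialDeriv i ψ) (memLp_partialDeriv i ψ _) k p.fst =
          - coordPairing ψ (testFn_memLp ψ _) k (p.snd i)} := by
    ext p
    simp only [Set.mem_iInter, Set.mem_ofPred_eq, coordPairing_apply]
    exact forall_congr' fun i => isWeakPartialDeriv_iff
  rw [e]
  refine isClosed_iInter fun i => isClosed_iInter fun ψ => isClosed_iInter fun k => ?_
  have c1 : Continuous fun p : WithLp 2 (L2 Ω × PiLp 2 (fun _ : Fin 3 => L2 Ω)) => p.fst :=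
    (WithLp.fstL 2 ℝ (L2 Ω) (PiLp 2 (fun _ : Fin 3 => L2 Ω))).continuous
  have c2 : Continuous fun p : WithLp 2 (L2 Ω × PiLp 2 (fun _ : Fin 3 => L2 Ω)) => p.snd i :=
    ((PiLp.proj 2 (𝕜 := ℝ) (fun _ : Fin 3 => L2 Ω) i).comp
      (WithLp.sndL 2 ℝ (L2 Ω) (PiLp 2 (fun _ : Fin 3 => L2 Ω)))).continuous
  exact isClosed_eq ((coordPairing _ _ k).continuous.comp c1)
    ((coordPairing _ _ k).continuous.comp c2).neg

instance completeSpace_W12 (Ω : Opens E3) : CompleteSpace (W12 Ω) :=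
  (isClosed_W12 Ω).completeSpace_coe

instance fact_two_ne_top : Fact ((2 : ℝ≥0∞) ≠ ∞) := ⟨by simp⟩

instance separableSpace_W12 (Ω : Opens E3) : SeparableSpace (W12 Ω) := by
  have : SecondCountableTopology (L2 Ω) := inferInstance
  have : SecondCountableTopology (PiLp 2 (fun _ : Fin 3 => L2 Ω)) := inferInstance
  have : SecondCountableTopology (WithLp 2 (L2 Ω × PiLp 2 (fun _ : Fin 3 => L2 Ω))) :=
    inferInstance
  infer_instance

end Sobolev

/-! ### Rellich's theorem on an open set -/

section LocalCompactness

variable {Ω : Opens E3}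

/-- The `k`-th coordinate of `χ w`, extended by zero to the whole space. -/
def cutoff (χ : 𝓓(Ω, ℝ)) (w : W12 Ω) (k : Fin 3) : E3 → ℝ :=
  (Ω : Set E3).indicator fun x => χ x * field w x k

theorem integral_cutoff_mul (χ : 𝓓(Ω, ℝ)) (w : W12 Ω) (k : Fin 3) (a : E3 → ℝ) :
    ∫ x, cutoff χ w k x * a x = ∫ x in (Ω : Set E3), χ x * field w x k * a x := by
  rw [← integral_indicator Ω.isOpen.measurableSet]
  refine integral_congr_ae (Eventually.of_forall fun x => ?_)
  by_cases hx : x ∈ (Ω : Set E3)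
  · simp [cutoff, hx]
  · simp [cutoff, hx]

theorem measurable_cutoff (χ : 𝓓(Ω, ℝ)) (w : W12 Ω) (k : Fin 3) : Measurable (cutoff χ w k) := by
  refine Measurable.indicator (χ.continuous.measurable.mul ?_) Ω.isOpen.measurableSet
  exact (EuclideanSpace.proj (𝕜 := ℝ) k : E3 →L[ℝ] ℝ).continuous.measurable.comp
    (Lp.stronglyMeasurable (field w)).measurable

theorem eLpNorm_cutoff (χ : 𝓓(Ω, ℝ)) (w : W12 Ω) (k : Fin 3) :
    eLpNorm (cutoff χ w k) 2 volume =
      eLpNorm (fun x => χ x * field w x k) 2 (volume.restrict (Ω : Set E3)) :=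
  eLpNorm_indicator_eq_eLpNorm_restrict Ω.isOpen.measurableSet

/-- The product of two test functions, one of them supported in `Ω`. -/
def mulTest (χ : 𝓓(Ω, ℝ)) (ψ : Test) : 𝓓(Ω, ℝ) :=
  ⟨fun x => χ x * ψ x, χ.contDiff.mul ψ.contDiff, χ.hasCompactSupport.mul_right,
    (tsupport_mul_subset_left (f := χ) (g := ψ)).trans χ.tsupport_subset⟩

theorem partialDeriv_mulTest (χ : 𝓓(Ω, ℝ)) (ψ : Test) (i : Fin 3) (x : E3) :
    partialDeriv i (mulTest χ ψ) x = χ x * partialDeriv i ψ x + ψ x * partialDeriv i χ x := by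
  have h1 : DifferentiableAt ℝ χ x := χ.contDiff.differentiable (by simp) x
  have h2 : DifferentiableAt ℝ ψ x := ψ.contDiff.differentiable (by simp) x
  change fderiv ℝ (fun x => χ x * ψ x) x _ = _
  rw [fderiv_fun_mul h1 h2]
  rfl

/-- The product rule for `∂ᵢ (χ w_k)`, on the whole space. -/
theorem integral_cutoff_mul_partialDeriv (χ : 𝓓(Ω, ℝ)) (w : W12 Ω) (k i : Fin 3) (ψ : Test) :
    ∫ x, cutoff χ w k x * partialDeriv i ψ x =
      - ((∫ x in (Ω : Set E3), (χ x * weakDeriv i w x k) * ψ x) +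
        ∫ x in (Ω : Set E3), (partialDeriv i χ x * field w x k) * ψ x) := by
  have h := isWeakPartialDeriv_iff.1 (w.2 i) (mulTest χ ψ) k
  change ∫ x in (Ω : Set E3), partialDeriv i (mulTest χ ψ) x * field w x k =
    - ∫ x in (Ω : Set E3), (χ x * ψ x) * weakDeriv i w x k at h
  obtain ⟨C, hC⟩ := χ.continuous.bounded_above_of_compact_support χ.hasCompactSupport
  obtain ⟨C', hC'⟩ := (continuous_partialDeriv i χ).bounded_above_of_compact_support
    (hasCompactSupport_partialDeriv i χ)
  have i1 : Integrable (fun x => χ x * field w x k * partialDeriv i ψ x)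
      (volume.restrict (Ω : Set E3)) :=
    (memLp_mul_coord χ.continuous hC (field w) k).1.integrable_mul (ψ.memLp_partialDeriv i _)
  have i2 : Integrable (fun x => partialDeriv i χ x * field w x k * ψ x)
      (volume.restrict (Ω : Set E3)) :=
    (memLp_mul_coord (continuous_partialDeriv i χ) hC' (field w) k).1.integrable_mul (ψ.memLp _)
  have e1 : ∫ x in (Ω : Set E3), partialDeriv i (mulTest χ ψ) x * field w x k =
      (∫ x in (Ω : Set E3), χ x * field w x k * partialDeriv i ψ x) +
      ∫ x in (Ω : Set E3), partialDeriv i χ x * field w x k * ψ x := by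
    rw [← integral_add i1 i2]
    refine integral_congr_ae (Eventually.of_forall fun x => ?_)
    simp only [partialDeriv_mulTest]
    ring
  have e2 : ∫ x in (Ω : Set E3), (χ x * ψ x) * weakDeriv i w x k =
      ∫ x in (Ω : Set E3), (χ x * weakDeriv i w x k) * ψ x :=
    integral_congr_ae (Eventually.of_forall fun x => by ring)
  rw [integral_cutoff_mul]
  rw [e1, e2] at h
  linarith

theorem fderiv_eq_sum (f : E3 → ℝ) (x z : E3) :
    fderiv ℝ f x z = ∑ i, z i * partialDeriv i f x := by
  conv_lhs => rw [eq_sum_smul_single z]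
  simp only [map_sum, map_smul, smul_eq_mul]
  rfl

/-- Cutoffs of a bounded family in `W^{1,2}(Ω)` are bounded in `W^{1,2}` of the whole space, the
derivative being bounded as a functional on test functions. -/
theorem exists_cutoff_bounds (χ : 𝓓(Ω, ℝ)) (M : ℝ) (hM : 0 ≤ M) : ∃ A : ℝ, 0 ≤ A ∧
    ∀ (w : W12 Ω) (k : Fin 3), ‖w‖ ≤ M →
      MemLp (cutoff χ w k) 2 volume ∧ (eLpNorm (cutoff χ w k) 2 volume).toReal ≤ A ∧
      ∀ (z : E3) (ψ : Test), |∫ x, cutoff χ w k x * fderiv ℝ ψ x z| ≤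
        A * ‖z‖ * (eLpNorm ψ 2 volume).toReal := by
  obtain ⟨C, hC⟩ := χ.continuous.bounded_above_of_compact_support χ.hasCompactSupport
  have hd : ∀ i, ∃ C', ∀ x, ‖partialDeriv i χ x‖ ≤ C' := fun i =>
    (continuous_partialDeriv i χ).bounded_above_of_compact_support
      (hasCompactSupport_partialDeriv i χ)
  choose C' hC' using hd
  have hC0 : 0 ≤ C := (norm_nonneg _).trans (hC 0)
  have hC'0 : ∀ i, 0 ≤ C' i := fun i => (norm_nonneg _).trans (hC' i 0)
  have hS0 : 0 ≤ ∑ i, (C * M + C' i * M) :=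
    Finset.sum_nonneg fun i _ => by have := hC'0 i; positivity
  refine ⟨C * M + ∑ i, (C * M + C' i * M), by positivity, fun w k hw => ?_⟩
  have b0 := memLp_mul_coord χ.continuous hC (field w) k
  have hL2 : MemLp (cutoff χ w k) 2 volume :=
    (memLp_indicator_iff_restrict Ω.isOpen.measurableSet).2 b0.1
  refine ⟨hL2, ?_, fun z ψ => ?_⟩
  · rw [eLpNorm_cutoff]
    have := mul_le_mul_of_nonneg_left ((norm_field_le w).trans hw) hC0
    linarith [b0.2]
  · set P := (eLpNorm ψ 2 volume).toReal with hP
    have hP0 : 0 ≤ P := ENNReal.toReal_nonneg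
    have hPr : (eLpNorm ψ 2 (volume.restrict (Ω : Set E3))).toReal ≤ P :=
      ENNReal.toReal_mono (ψ.memLp volume).eLpNorm_ne_top
        (eLpNorm_mono_measure _ Measure.restrict_le_self)
    have hpart : ∀ i, |∫ x, cutoff χ w k x * partialDeriv i ψ x| ≤ (C * M + C' i * M) * P := by
      intro i
      have b1 := memLp_mul_coord χ.continuous hC (weakDeriv i w) k
      have b2 := memLp_mul_coord (continuous_partialDeriv i χ) (hC' i) (field w) k
      have c1 := abs_integral_mul_le b1.1 (ψ.memLp (volume.restrict (Ω : Set E3)))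
      have c2 := abs_integral_mul_le b2.1 (ψ.memLp (volume.restrict (Ω : Set E3)))
      have d1 := mul_le_mul (b1.2.trans (mul_le_mul_of_nonneg_left
        ((norm_weakDeriv_le i w).trans hw) hC0)) hPr ENNReal.toReal_nonneg (by positivity)
      have d2 := mul_le_mul (b2.2.trans (mul_le_mul_of_nonneg_left
        ((norm_field_le w).trans hw) (hC'0 i))) hPr ENNReal.toReal_nonneg
        (mul_nonneg (hC'0 i) hM)
      rw [integral_cutoff_mul_partialDeriv, abs_neg, add_mul]
      exact (abs_add_le _ _).trans (add_le_add (c1.trans d1) (c2.trans d2))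
    have hint : ∀ i, Integrable (fun x => cutoff χ w k x * partialDeriv i ψ x) := fun i =>
      hL2.integrable_mul (ψ.memLp_partialDeriv i _)
    have e : ∫ x, cutoff χ w k x * fderiv ℝ ψ x z =
        ∑ i, z i * ∫ x, cutoff χ w k x * partialDeriv i ψ x := by
      simp only [← integral_const_mul]
      rw [← integral_finsetSum _ fun i _ => (hint i).const_mul (z i)]
      refine integral_congr_ae (Eventually.of_forall fun x => ?_)
      simp only [fderiv_eq_sum, Finset.mul_sum]
      exact Finset.sum_congr rfl fun i _ => by ring
    rw [e]
    calc |∑ i, z i * ∫ x, cutoff χ w k x * partialDeriv i ψ x|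
        ≤ ∑ i, |z i * ∫ x, cutoff χ w k x * partialDeriv i ψ x| := Finset.abs_sum_le_sum_abs _ _
      _ ≤ ∑ i, ‖z‖ * ((C * M + C' i * M) * P) := by
          refine Finset.sum_le_sum fun i _ => ?_
          rw [abs_mul]
          exact mul_le_mul (abs_coord_le z i) (hpart i) (abs_nonneg _) (norm_nonneg _)
      _ = (∑ i, (C * M + C' i * M)) * ‖z‖ * P := by
          rw [← Finset.mul_sum, ← Finset.sum_mul]; ring
      _ ≤ _ := by
          have : 0 ≤ C * M * ‖z‖ * P := by positivity
          nlinarith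

theorem tendsto_lintegral_cutoff (χ : 𝓓(Ω, ℝ)) {w : ℕ → W12 Ω} {M : ℝ} (hM : ∀ j, ‖w j‖ ≤ M)
    (hw : WeaklyTendsto w 0) (k : Fin 3) :
    Tendsto (fun j => ∫⁻ x, ‖cutoff χ (w j) k x‖ₑ) atTop (𝓝 0) := by
  have hM0 : 0 ≤ M := (norm_nonneg _).trans (hM 0)
  obtain ⟨A, hA0, hA⟩ := exists_cutoff_bounds χ M hM0
  refine tendsto_lintegral_enorm_of_weak (fun j => measurable_cutoff χ (w j) k)
    (fun j => (hA _ k (hM j)).1) χ.hasCompactSupport.isCompact (fun j x hx => ?_) hA0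
    (fun j => (hA _ k (hM j)).2.1) (fun j => (hA _ k (hM j)).2.2) (fun a ha => ?_)
  · rw [cutoff, Set.indicator_apply_eq_zero]
    intro _
    rw [image_eq_zero_of_notMem_tsupport hx, zero_mul]
  · obtain ⟨C, hC⟩ := χ.continuous.bounded_above_of_compact_support χ.hasCompactSupport
    have hχa : MemLp (fun x => χ x * a x) 2 (volume.restrict (Ω : Set E3)) :=
      (ha.restrict _).of_le_mul (c := C)
        (χ.continuous.aestronglyMeasurable.mul (ha.restrict _).aestronglyMeasurable)
        (Eventually.of_forall fun x => by
          rw [norm_mul]; exact mul_le_mul_of_nonneg_right (hC x) (norm_nonneg _))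
    have h := weaklyTendsto_iff.1 hw ((coordPairing _ hχa k).comp (fieldL Ω))
    rw [map_zero] at h
    refine h.congr fun j => ?_
    rw [integral_cutoff_mul, ContinuousLinearMap.comp_apply, coordPairing_apply]
    exact integral_congr_ae (Eventually.of_forall fun x => by
      simp only [fieldL_apply]; ring)

theorem exists_test_eq_one {K : Set E3} (hK : IsCompact K) (hKΩ : K ⊆ Ω) :
    ∃ χ : 𝓓(Ω, ℝ), ∀ x ∈ K, χ x = 1 := by
  obtain ⟨L, hL, hKL, hLΩ⟩ := exists_compact_between hK Ω.isOpen hKΩ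
  obtain ⟨f, h1, h0, -⟩ := exists_contMDiffMap_one_nhds_of_subset_interior
    (modelWithCornersSelf ℝ E3) (n := ⊤) hK.isClosed hKL
  have hs : tsupport f ⊆ L := closure_minimal
    (fun x hx => by by_contra hxL; exact hx (h0 x hxL)) hL.isClosed
  exact ⟨⟨f, f.contMDiff.contDiff, hL.of_isClosed_subset (isClosed_tsupport _) hs, hs.trans hLΩ⟩,
    fun x hx => h1.self_of_nhdsSet x hx⟩

/-- **Rellich's theorem** on an arbitrary open set of finite measure, with convergence in `L¹`: no
regularity of the boundary is needed, since a thin neighbourhood of it carries little of the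
`L¹` norm. -/
theorem tendsto_lintegral_enorm_field (hΩ : volume (Ω : Set E3) ≠ ∞) {w : ℕ → W12 Ω} {M : ℝ}
    (hM : ∀ j, ‖w j‖ ≤ M) (hw : WeaklyTendsto w 0) :
    Tendsto (fun j => ∫⁻ x in (Ω : Set E3), ‖field (w j) x‖ₑ) atTop (𝓝 0) := by
  rw [ENNReal.tendsto_nhds_zero]
  intro ε hε
  have hε2 : 0 < ε / 2 := ENNReal.half_pos hε.ne'
  obtain ⟨η, hη0, hη⟩ : ∃ η : ℝ≥0∞, 0 < η ∧ ENNReal.ofReal M * η ^ ((1 : ℝ) / 2) ≤ ε / 2 := by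
    have h1 : Tendsto (fun η : ℝ≥0∞ => ENNReal.ofReal M * η ^ ((1 : ℝ) / 2)) (𝓝 0) (𝓝 0) := by
      have h2 := (ENNReal.continuous_rpow_const (y := (1 : ℝ) / 2)).tendsto 0
      rw [ENNReal.zero_rpow_of_pos (by norm_num)] at h2
      simpa using ENNReal.Tendsto.const_mul h2 (Or.inr ENNReal.ofReal_ne_top)
    have h3 : ∀ᶠ η in 𝓝[>] (0 : ℝ≥0∞), ENNReal.ofReal M * η ^ ((1 : ℝ) / 2) ≤ ε / 2 :=
      (h1.mono_left nhdsWithin_le_nhds).eventually (ge_mem_nhds hε2)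
    obtain ⟨η, h4, h5⟩ := (h3.and self_mem_nhdsWithin).exists
    exact ⟨η, h5, h4⟩
  obtain ⟨K, hKΩ, hKc, hK⟩ := Ω.isOpen.measurableSet.exists_isCompact_sdiff_lt hΩ hη0.ne'
  obtain ⟨χ, hχ⟩ := exists_test_eq_one hKc hKΩ
  have hcut : Tendsto (fun j => ∑ k, ∫⁻ x, ‖cutoff χ (w j) k x‖ₑ) atTop (𝓝 0) := by
    simpa using tendsto_finsetSum Finset.univ fun k _ => tendsto_lintegral_cutoff χ hM hw k
  filter_upwards [ENNReal.tendsto_nhds_zero.1 hcut _ hε2] with j hj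
  have hsplit : ∫⁻ x in (Ω : Set E3), ‖field (w j) x‖ₑ =
      (∫⁻ x in K, ‖field (w j) x‖ₑ) + ∫⁻ x in (Ω : Set E3) \ K, ‖field (w j) x‖ₑ := by
    rw [← lintegral_inter_add_sdiff _ _ hKc.measurableSet, Set.inter_eq_right.2 hKΩ]
  -- the part near the boundary, by the Cauchy–Schwarz inequality
  have hnear : ∫⁻ x in (Ω : Set E3) \ K, ‖field (w j) x‖ₑ ≤ ε / 2 := by
    have h2 := eLpNorm_le_eLpNorm_mul_rpow_measure_univ (μ := volume.restrict
      ((Ω : Set E3) \ K)) (f := field (w j)) (p := 1) (q := 2) (by norm_num)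
      ((Lp.stronglyMeasurable (field (w j))).aestronglyMeasurable)
    rw [Measure.restrict_apply_univ, eLpNorm_one_eq_lintegral_enorm] at h2
    have e : (1 / (1 : ℝ≥0∞).toReal - 1 / (2 : ℝ≥0∞).toReal) = (1 : ℝ) / 2 := by norm_num
    rw [e] at h2
    refine (h2.trans ?_).trans hη
    gcongr
    refine (eLpNorm_mono_measure _ (Measure.restrict_mono Set.sdiff_subset le_rfl)).trans ?_
    rw [ENNReal.le_ofReal_iff_toReal_le (Lp.eLpNorm_ne_top _) ((norm_nonneg _).trans (hM j)),
      ← Lp.norm_def]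
    exact (norm_field_le _).trans (hM j)
  -- the part in `K`, where the cutoff is one
  have hfar : ∫⁻ x in K, ‖field (w j) x‖ₑ ≤ ε / 2 := by
    refine le_trans ?_ hj
    rw [← lintegral_finsetSum _ fun k _ => (measurable_cutoff χ (w j) k).enorm]
    refine (setLIntegral_mono_ae' hKc.measurableSet (Eventually.of_forall fun x hx => ?_)).trans
      (setLIntegral_le_lintegral K _)
    have e : ∀ k, cutoff χ (w j) k x = field (w j) x k := by
      intro k
      rw [cutoff, Set.indicator_of_mem (hKΩ hx), hχ x hx, one_mul]
    simp only [e]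
    conv_lhs => rw [eq_sum_smul_single (field (w j) x)]
    refine (enorm_sum_le _ _).trans (Finset.sum_le_sum fun k _ => ?_)
    rw [enorm_smul]
    simp [enorm_eq_nnnorm]
  rw [hsplit]
  exact (add_le_add hfar hnear).trans_eq (ENNReal.add_halves ε)

end LocalCompactness

/-! ### The magnetostatic constraints and their limit -/

section MagneticOperators

theorem fin_four_eq_zero_iff {A : Fin 4 → Test → ℝ} :
    A = 0 ↔ ∀ ψ, A 0 ψ = 0 ∧ A 1 ψ = 0 ∧ A 2 ψ = 0 ∧ A 3 ψ = 0 := by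
  refine ⟨fun h ψ => by simp [h], fun h => ?_⟩
  ext k ψ
  fin_cases k
  exacts [(h ψ).1, (h ψ).2.1, (h ψ).2.2.1, (h ψ).2.2.2]

theorem distDerivEps_apply (ε : ℝ) (i : Fin 3) (f : E3 → ℝ) (ψ : Test) :
    distDerivEps ε i f ψ = (if i = 2 then ε⁻¹ else 1) * distDeriv i f ψ := rfl

theorem Aeps_eq_zero_iff {ε : ℝ} {m h : E3 → E3} : Aeps ε m h = 0 ↔ ∀ ψ : Test,
    ((∫ x, (m x 0 + h x 0) * partialDeriv 0 ψ x) + (∫ x, (m x 1 + h x 1) * partialDeriv 1 ψ x)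
        + ε⁻¹ * ∫ x, (m x 2 + h x 2) * partialDeriv 2 ψ x = 0) ∧
    (∫ x, h x 2 * partialDeriv 1 ψ x = ε⁻¹ * ∫ x, h x 1 * partialDeriv 2 ψ x) ∧
    (ε⁻¹ * ∫ x, h x 0 * partialDeriv 2 ψ x = ∫ x, h x 2 * partialDeriv 0 ψ x) ∧
    (∫ x, h x 1 * partialDeriv 0 ψ x = ∫ x, h x 0 * partialDeriv 1 ψ x) := by
  rw [fin_four_eq_zero_iff]
  refine forall_congr' fun ψ => ?_
  simp only [Aeps, Matrix.cons_val_zero, Matrix.cons_val_one, Matrix.cons_val, Pi.add_apply,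
    Pi.sub_apply, distDerivEps_apply, distDeriv, Fin.reduceEq, reduceIte, one_mul]
  refine and_congr ?_ (and_congr ?_ (and_congr ?_ ?_)) <;>
  constructor <;> intro H <;> linarith

theorem A0_eq_zero_iff {m h : E3 → E3} : A0 m h = 0 ↔ ∀ ψ : Test,
    (∫ x, (m x 2 + h x 2) * partialDeriv 2 ψ x = 0) ∧
    (∫ x, h x 1 * partialDeriv 2 ψ x = 0) ∧
    (∫ x, h x 0 * partialDeriv 2 ψ x = 0) ∧
    (∫ x, h x 1 * partialDeriv 0 ψ x = ∫ x, h x 0 * partialDeriv 1 ψ x) := by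
  rw [fin_four_eq_zero_iff]
  refine forall_congr' fun ψ => ?_
  simp only [A0, Matrix.cons_val_zero, Matrix.cons_val_one, Matrix.cons_val, Pi.neg_apply,
    Pi.sub_apply, distDeriv]
  refine and_congr ?_ (and_congr ?_ (and_congr ?_ ?_)) <;>
  constructor <;> intro H <;> linarith

variable {Ω : Opens E3}

theorem memLp_zeroExt (m : W12 Ω) : MemLp (zeroExt m) 2 volume :=
  (memLp_indicator_iff_restrict Ω.isOpen.measurableSet).2 (Lp.memLp (field m))

/-- The extension by zero, as an element of `L²(ℝ³; ℝ³)`. -/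
def extL2 (m : W12 Ω) : L2Space := (memLp_zeroExt m).toLp _

theorem coeFn_extL2 (m : W12 Ω) : extL2 m =ᵐ[volume] zeroExt m := (memLp_zeroExt m).coeFn_toLp

theorem memLp_zeroExt_coord (m : W12 Ω) (k : Fin 3) : MemLp (fun x => zeroExt m x k) 2 volume :=
  (EuclideanSpace.proj (𝕜 := ℝ) k : E3 →L[ℝ] ℝ).comp_memLp' (memLp_zeroExt m)

theorem integral_zeroExt_mul (m : W12 Ω) (k : Fin 3) (a : E3 → ℝ) :
    ∫ x, zeroExt m x k * a x = ∫ x in (Ω : Set E3), a x * field m x k := by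
  rw [← integral_indicator Ω.isOpen.measurableSet]
  refine integral_congr_ae (Eventually.of_forall fun x => ?_)
  by_cases hx : x ∈ (Ω : Set E3)
  · simp [zeroExt, hx, mul_comm]
  · simp [zeroExt, hx]

theorem WeaklyTendsto.tendsto_integral_coord {h : ℕ → L2Space} {h₀ : L2Space}
    (hh : WeaklyTendsto h h₀) {a : E3 → ℝ} (ha : MemLp a 2 volume) (k : Fin 3) :
    Tendsto (fun j => ∫ x, h j x k * a x) atTop (𝓝 (∫ x, h₀ x k * a x)) := by
  have := weaklyTendsto_iff.1 hh (coordPairing a ha k)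
  simpa only [coordPairing_apply, mul_comm] using this

theorem WeaklyTendsto.tendsto_integral_zeroExt {m : ℕ → W12 Ω} {m₀ : W12 Ω}
    (hm : WeaklyTendsto m m₀) {a : E3 → ℝ} (ha : MemLp a 2 volume) (k : Fin 3) :
    Tendsto (fun j => ∫ x, zeroExt (m j) x k * a x) atTop (𝓝 (∫ x, zeroExt m₀ x k * a x)) := by
  have := weaklyTendsto_iff.1 hm
    ((coordPairing a (ha.restrict (Ω : Set E3)) k).comp (fieldL Ω))
  simpa only [integral_zeroExt_mul, ContinuousLinearMap.comp_apply, coordPairing_apply,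
    fieldL_apply] using this

theorem integral_add_mul (m : W12 Ω) (h : L2Space) (k : Fin 3) {a : E3 → ℝ}
    (ha : MemLp a 2 volume) : ∫ x, (zeroExt m x k + h x k) * a x =
      (∫ x, zeroExt m x k * a x) + ∫ x, h x k * a x := by
  have e : ∀ x, (zeroExt m x k + h x k) * a x = zeroExt m x k * a x + h x k * a x :=
    fun x => add_mul _ _ _
  simp only [e]
  exact integral_add ((memLp_zeroExt_coord m k).integrable_mul ha)
    ((memLp_coord h k).integrable_mul ha)

/-- The constraints `div_ε (m + h) = 0`, `curl_ε h = 0` pass to the limit `𝒜₀ (m, h) = 0` along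
weakly convergent sequences. -/
theorem A0_eq_zero_of_weaklyTendsto {ε : ℕ → ℝ} (hε : ToZeroPlus ε) {m : ℕ → W12 Ω} {m₀ : W12 Ω}
    (hm : WeaklyTendsto m m₀) {h : ℕ → L2Space} {h₀ : L2Space} (hh : WeaklyTendsto h h₀)
    (hA : ∀ j, Aeps (ε j) (zeroExt (m j)) (h j) = 0) : A0 (zeroExt m₀) h₀ = 0 := by
  refine A0_eq_zero_iff.2 fun ψ => ?_
  have hA' := fun j => Aeps_eq_zero_iff.1 (hA j) ψ
  have hd := fun i => ψ.memLp_partialDeriv i volume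
  have lh := fun i k => hh.tendsto_integral_coord (hd i) k
  have lm : ∀ i k, Tendsto (fun j => ∫ x, (zeroExt (m j) x k + h j x k) * partialDeriv i ψ x) atTop
      (𝓝 (∫ x, (zeroExt m₀ x k + h₀ x k) * partialDeriv i ψ x)) := by
    intro i k
    simp only [fun m h => integral_add_mul (Ω := Ω) m h k (hd i)]
    exact (hm.tendsto_integral_zeroExt (hd i) k).add (lh i k)
  -- a bounded multiple of `ε` is negligible
  have kill : ∀ {a b : ℕ → ℝ} {a₀ b₀ : ℝ}, Tendsto a atTop (𝓝 a₀) → Tendsto b atTop (𝓝 b₀) →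
      (∀ j, (ε j)⁻¹ * a j = b j) → a₀ = 0 := by
    intro a b a₀ b₀ ha hb hab
    have h1 : Tendsto (fun j => ε j * b j) atTop (𝓝 0) := by simpa using hε.2.mul hb
    refine tendsto_nhds_unique ha (h1.congr fun j => ?_)
    rw [← hab, mul_inv_cancel_left₀ (hε.1 j).ne']
  refine ⟨?_, ?_, ?_, ?_⟩
  · refine kill (lm 2 2) ((lm 0 0).add (lm 1 1)).neg fun j => ?_
    linarith [(hA' j).1]
  · exact kill (lh 2 1) (lh 1 2) fun j => (hA' j).2.1.symm
  · exact kill (lh 2 0) (lh 0 2) fun j => (hA' j).2.2.1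
  · exact tendsto_nhds_unique (lh 0 1) ((lh 1 0).congr fun j => (hA' j).2.2.2.symm)

/-- In the limit, the stray field is `h = -m₃ e₃`. -/
theorem ae_of_A0_eq_zero {m : W12 Ω} {h : L2Space} (hA : A0 (zeroExt m) h = 0) :
    ∀ᵐ x, h x 0 = 0 ∧ h x 1 = 0 ∧ h x 2 = - zeroExt m x 2 := by
  have hz : (EuclideanSpace.single 2 1 : E3) ≠ 0 := by simp
  have h' := A0_eq_zero_iff.1 hA
  have a0 := ae_eq_zero_of_integral_mul_fderiv_eq_zero (memLp_coord h 0) hz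
    fun ψ => (h' ψ).2.2.1
  have a1 := ae_eq_zero_of_integral_mul_fderiv_eq_zero (memLp_coord h 1) hz
    fun ψ => (h' ψ).2.1
  have a2 := ae_eq_zero_of_integral_mul_fderiv_eq_zero
    ((memLp_zeroExt_coord m 2).add (memLp_coord h 2)) hz fun ψ => (h' ψ).1
  filter_upwards [a0, a1, a2] with x h0 h1 h2
  refine ⟨h0, h1, ?_⟩
  have h3 : zeroExt m x 2 + h x 2 = 0 := h2
  linarith

theorem eq_of_A0_eq_zero {m : W12 Ω} {h h' : L2Space} (hA : A0 (zeroExt m) h = 0)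
    (hA' : A0 (zeroExt m) h' = 0) : h = h' := by
  refine Lp.ext ?_
  filter_upwards [ae_of_A0_eq_zero hA, ae_of_A0_eq_zero hA'] with x h1 h2
  ext k
  fin_cases k
  · exact h1.1.trans h2.1.symm
  · exact h1.2.1.trans h2.2.1.symm
  · exact h1.2.2.trans h2.2.2.symm

/-- The same identity as for the stray fields at positive `ε`; it turns weak convergence of stray
fields into convergence of their norms. -/
theorem norm_sq_of_A0_eq_zero {m : W12 Ω} {h : L2Space} (hA : A0 (zeroExt m) h = 0) :
    ‖h‖ ^ 2 = - inner ℝ (extL2 m) h := by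
  rw [← real_inner_self_eq_norm_sq, L2.inner_def, L2.inner_def, ← integral_neg]
  refine integral_congr_ae ?_
  filter_upwards [ae_of_A0_eq_zero hA, coeFn_extL2 m] with x hx hm
  rw [hm]
  simp only [PiLp.inner_apply, Fin.sum_univ_three, hx.1, hx.2.1, hx.2.2]
  simp [sq]

end MagneticOperators

/-! ### Existence and convergence of stray fields -/

section StrayField

/-- The field `(∂ᵢ ψ) e_k`. -/
def derivField (i k : Fin 3) (ψ : Test) : L2Space :=
  (memLp_smul_single (ψ.memLp_partialDeriv i volume) k).toLp _

theorem inner_derivField (i k : Fin 3) (ψ : Test) (u : L2Space) :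
    inner ℝ (derivField i k ψ) u = ∫ x, u x k * partialDeriv i ψ x := by
  have := coordPairing_apply (ψ.memLp_partialDeriv i volume) k u
  simp only [mul_comm] at this
  exact this

theorem inner_derivField_derivField (i k j l : Fin 3) (ψ η : Test) :
    inner ℝ (derivField i k ψ) (derivField j l η) =
      if k = l then ∫ x, partialDeriv j η x * partialDeriv i ψ x else 0 := by
  rw [inner_derivField]
  have e : ∫ x, derivField j l η x k * partialDeriv i ψ x =
      ∫ x, (if k = l then partialDeriv j η x else 0) * partialDeriv i ψ x := by
    refine integral_congr_ae ?_
    filter_upwards [(memLp_smul_single (η.memLp_partialDeriv j volume) l).coeFn_toLp] with x hx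
    change ((memLp_smul_single (η.memLp_partialDeriv j volume) l).toLp _ : L2Space) x k * _ = _
    rw [hx]
    simp [PiLp.single_apply]
  rw [e]
  split_ifs <;> simp

/-- The classical partial derivative of a test function, as a test function. -/
def Test.deriv (ψ : Test) (i : Fin 3) : Test :=
  Test.mk (partialDeriv i ψ) ((ψ.contDiff.fderiv_right (m := (⊤ : ℕ∞)) (by simp)).clm_apply
    contDiff_const) (hasCompactSupport_partialDeriv i ψ)

theorem partialDeriv_comm (ψ : Test) (i j : Fin 3) (x : E3) :
    partialDeriv i (ψ.deriv j) x = partialDeriv j (ψ.deriv i) x := by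
  have hd : DifferentiableAt ℝ (fderiv ℝ ψ) x :=
    (ψ.contDiff.fderiv_right (m := (⊤ : ℕ∞)) (by simp)).differentiable (by simp) x
  have e : ∀ i j : Fin 3, partialDeriv i (ψ.deriv j) x =
      fderiv ℝ (fderiv ℝ ψ) x (EuclideanSpace.single i 1) (EuclideanSpace.single j 1) := by
    intro i j
    change fderiv ℝ (fun y => fderiv ℝ ψ y (EuclideanSpace.single j 1)) x _ = _
    rw [fderiv_clm_apply hd (differentiableAt_const _)]
    simp
  rw [e, e]
  exact (ψ.contDiff.contDiffAt (x := x)).isSymmSndFDerivAt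
    (by
      rw [minSmoothness_of_isRCLikeNormedField]
      exact WithTop.coe_le_coe.2 (le_top : (2 : ℕ∞) ≤ ⊤)) _ _

theorem integral_partialDeriv_mul (ψ η : Test) (i : Fin 3) :
    ∫ x, ψ x * partialDeriv i η x = - ∫ x, partialDeriv i ψ x * η x :=
  integral_mul_fderiv_eq_neg_fderiv_mul_of_integrable
    ((ψ.memLp_partialDeriv i volume).integrable_mul (η.memLp volume))
    ((ψ.memLp volume).integrable_mul (η.memLp_partialDeriv i volume))
    ((ψ.memLp volume).integrable_mul (η.memLp volume))
    (fun x _ => ψ.contDiff.differentiable (by simp) x)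
    (fun x _ => η.contDiff.differentiable (by simp) x)

theorem integral_partialDeriv_mul_comm (ψ η : Test) (i j : Fin 3) :
    ∫ x, partialDeriv j η x * partialDeriv i ψ x =
      ∫ x, partialDeriv i η x * partialDeriv j ψ x := by
  have h1 := integral_partialDeriv_mul (η.deriv j) ψ i
  have h2 := integral_partialDeriv_mul (η.deriv i) ψ j
  change ∫ x, partialDeriv j η x * partialDeriv i ψ x = _ at h1
  change ∫ x, partialDeriv i η x * partialDeriv j ψ x = _ at h2
  rw [h1, h2]
  simp only [partialDeriv_comm η i j]

/-- The gradient with weights `c` of a test function, `(c₀ ∂₀ψ, c₁ ∂₁ψ, c₂ ∂₂ψ)`; the weights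
`(1, 1, ε⁻¹)` give `∇_ε`. -/
def gradField (c : Fin 3 → ℝ) (ψ : Test) : L2Space := ∑ i, c i • derivField i i ψ

/-- The rescaled gradient fields in `L²`: the closure of the gradients of test functions. -/
def gradSpace (c : Fin 3 → ℝ) : Submodule ℝ L2Space :=
  (Submodule.span ℝ (Set.range (gradField c))).topologicalClosure

instance completeSpace_gradSpace (c : Fin 3 → ℝ) : CompleteSpace (gradSpace c) :=
  (Submodule.isClosed_topologicalClosure _).completeSpace_coe

theorem inner_eq_zero_of_mem_gradSpace {c : Fin 3 → ℝ} {h v : L2Space} (hh : h ∈ gradSpace c)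
    (hv : ∀ ψ, inner ℝ (gradField c ψ) v = 0) : inner ℝ h v = 0 := by
  have hle : gradSpace c ≤ (ℝ ∙ v)ᗮ := by
    refine Submodule.topologicalClosure_minimal _ (Submodule.span_le.2 ?_)
      (Submodule.isClosed_orthogonal _)
    rintro _ ⟨ψ, rfl⟩
    exact Submodule.mem_orthogonal_singleton_iff_inner_left.2 (hv ψ)
  exact Submodule.mem_orthogonal_singleton_iff_inner_left.1 (hle hh)

/-- The elements of `gradSpace` are rescaled curl-free, because curls of test fields are
divergence-free. -/
theorem curl_eq_zero_of_mem_gradSpace {c : Fin 3 → ℝ} {h : L2Space} (hh : h ∈ gradSpace c)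
    (i j : Fin 3) (η : Test) :
    c j * ∫ x, h x i * partialDeriv j η x = c i * ∫ x, h x j * partialDeriv i η x := by
  have key := inner_eq_zero_of_mem_gradSpace hh
    (v := c j • derivField j i η - c i • derivField i j η) fun ψ => by
      simp only [gradField, inner_sub_right, sum_inner, inner_smul_left, inner_smul_right,
        inner_derivField_derivField, mul_ite, mul_zero, Finset.sum_ite_eq', Finset.mem_univ,
        if_true, conj_trivial]
      rw [integral_partialDeriv_mul_comm ψ η i j]
      ring
  rw [real_inner_comm, inner_sub_left, inner_smul_left, inner_smul_left, inner_derivField,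
    inner_derivField] at key
  simpa [sub_eq_zero] using key

/-- Every magnetisation has a stray field: minus its projection on the gradients. The identity for
the norm says that the stray field is orthogonal to `m + h`. -/
theorem exists_strayField {Ω : Opens E3} (m : W12 Ω) (ε : ℝ) : ∃ h : L2Space,
    Aeps ε (zeroExt m) h = 0 ∧ ‖h‖ ^ 2 = - inner ℝ (extL2 m) h := by
  set c : Fin 3 → ℝ := fun i => if i = 2 then ε⁻¹ else 1 with hc
  set h : L2Space := - (gradSpace c).starProjection (extL2 m) with hh
  have hmem : h ∈ gradSpace c := Submodule.neg_mem _ (Submodule.starProjection_apply_mem _ _)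
  have horth : extL2 m + h ∈ (gradSpace c)ᗮ := by
    rw [hh, ← sub_eq_add_neg]
    exact Submodule.sub_starProjection_mem_orthogonal _
  have c0 : c 0 = 1 := by simp [hc]
  have c1 : c 1 = 1 := by simp [hc]
  have c2 : c 2 = ε⁻¹ := by simp [hc]
  refine ⟨h, Aeps_eq_zero_iff.2 fun ψ => ⟨?_, ?_, ?_, ?_⟩, ?_⟩
  · have hg : gradField c ψ ∈ gradSpace c :=
      Submodule.le_topologicalClosure _ (Submodule.subset_span ⟨ψ, rfl⟩)
    have h0 := (Submodule.mem_orthogonal _ _).1 horth _ hg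
    have e : ∀ i k, inner ℝ (derivField i k ψ) (extL2 m + h) =
        ∫ x, (zeroExt m x k + h x k) * partialDeriv i ψ x := by
      intro i k
      rw [inner_derivField]
      refine integral_congr_ae ?_
      filter_upwards [Lp.coeFn_add (extL2 m) h, coeFn_extL2 m] with x h1 h2
      rw [h1, Pi.add_apply, h2]
      rfl
    rw [gradField, sum_inner] at h0
    simpa only [inner_smul_left, Fin.sum_univ_three, e, c0, c1, c2, conj_trivial, one_mul] using h0
  · simpa [c0, c1, c2] using curl_eq_zero_of_mem_gradSpace hmem 2 1 ψ
  · simpa [c0, c1, c2] using curl_eq_zero_of_mem_gradSpace hmem 0 2 ψ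
  · simpa [c0, c1, c2] using curl_eq_zero_of_mem_gradSpace hmem 1 0 ψ
  · have h0 := (Submodule.mem_orthogonal _ _).1 horth _ hmem
    rw [inner_add_right, real_inner_self_eq_norm_sq, real_inner_comm] at h0
    linarith

/-- The stray fields of a fixed magnetisation converge, weakly and in norm, to the stray field of
the limit problem. -/
theorem exists_strayField_tendsto {Ω : Opens E3} {m : W12 Ω} {h : L2Space}
    (hA : A0 (zeroExt m) h = 0) {ε : ℕ → ℝ} (hε : ToZeroPlus ε) : ∃ H : ℕ → L2Space,
    (∀ j, Aeps (ε j) (zeroExt m) (H j) = 0) ∧ WeaklyTendsto H h ∧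
      Tendsto (fun j => ‖H j‖ ^ 2) atTop (𝓝 (‖h‖ ^ 2)) := by
  choose H hH hn using fun j => exists_strayField m (ε j)
  have hbd : ∀ j, ‖H j‖ ≤ ‖extL2 m‖ := by
    intro j
    have h1 := abs_real_inner_le_norm (extL2 m) (H j)
    have h2 := neg_abs_le (inner ℝ (extL2 m) (H j))
    have h3 : ‖H j‖ * ‖H j‖ ≤ ‖extL2 m‖ * ‖H j‖ := by
      have := hn j
      rw [sq] at this
      linarith
    rcases (norm_nonneg (H j)).eq_or_lt with h0 | h0
    · rw [← h0]; exact norm_nonneg _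
    · exact le_of_mul_le_mul_right h3 h0
  have hw : WeaklyTendsto H h := by
    refine weaklyTendsto_of_inner fun y => tendsto_of_subseq_tendsto fun ns hns => ?_
    obtain ⟨k, h', hk, hk'⟩ := exists_weaklyTendsto_subseq (u := H ∘ ns) fun j => hbd _
    have hA' : A0 (zeroExt m) h' = 0 :=
      A0_eq_zero_of_weaklyTendsto (ε := ε ∘ ns ∘ k)
        ⟨fun j => hε.1 _, hε.2.comp (hns.comp hk.tendsto_atTop)⟩ (weaklyTendsto_const m) hk'
        fun j => hH _
    rw [eq_of_A0_eq_zero hA hA']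
    exact ⟨k, hk'.inner_right y⟩
  refine ⟨H, hH, hw, ?_⟩
  rw [norm_sq_of_A0_eq_zero hA]
  simp only [hn]
  exact (hw.inner_right _).neg

end StrayField

/-! ### Energies and a priori bounds -/

section Energy

theorem lintegral_ofReal_norm_sq {α E : Type*} [MeasurableSpace α] {μ : Measure α}
    [NormedAddCommGroup E] [InnerProductSpace ℝ E] {c : ℝ} (hc : 0 ≤ c) (f : Lp E 2 μ) :
    ∫⁻ x, ENNReal.ofReal (c * ‖f x‖ ^ 2) ∂μ = ENNReal.ofReal (c * ‖f‖ ^ 2) := by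
  have hint : Integrable (fun x => ‖f x‖ ^ 2) μ := by
    simpa only [real_inner_self_eq_norm_sq] using L2.integrable_inner (𝕜 := ℝ) f f
  have hn : ‖f‖ ^ 2 = ∫ x, ‖f x‖ ^ 2 ∂μ := by
    rw [← real_inner_self_eq_norm_sq, L2.inner_def]
    simp only [real_inner_self_eq_norm_sq]
  rw [hn, ← integral_const_mul, ofReal_integral_eq_lintegral_ofReal (hint.const_mul c)
    (Eventually.of_forall fun x => by positivity)]

/-- The anisotropy energy `∫_Ω φ(m)`. -/
def anisotropy {Ω : Opens E3} (φ : E3 → ℝ) (m : W12 Ω) : ℝ≥0∞ :=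
  ∫⁻ x in (Ω : Set E3), ENNReal.ofReal (φ (field m x))

/-- The energy splits into norms and the anisotropy. The factor `r` is `ε⁻¹` for `F_ε`, and `0`
for `F_0`. -/
theorem lintegral_energy {Ω : Opens E3} {α : ℝ} (hα : 0 ≤ α) {φ : E3 → ℝ} (hφ : ∀ v, 0 ≤ φ v)
    (r : ℝ) (m : W12 Ω) (h : L2Space) :
    (∫⁻ x in (Ω : Set E3), ENNReal.ofReal
      (α * (‖weakDeriv 0 m x‖ ^ 2 + ‖weakDeriv 1 m x‖ ^ 2 + ‖r • weakDeriv 2 m x‖ ^ 2)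
        + φ (field m x)))
      + ∫⁻ x, ENNReal.ofReal (1 / 2 * ‖h x‖ ^ 2) =
    ENNReal.ofReal (α * (‖weakDeriv 0 m‖ ^ 2 + ‖weakDeriv 1 m‖ ^ 2 + ‖r • weakDeriv 2 m‖ ^ 2)
      + 1 / 2 * ‖h‖ ^ 2) + anisotropy φ m := by
  have hmeas : ∀ c : ℝ, ∀ f : L2 Ω, Measurable fun x => ENNReal.ofReal (c * ‖f x‖ ^ 2) := by
    intro c f
    exact ((((Lp.stronglyMeasurable f).norm.measurable.pow_const 2).const_mul c)).ennreal_ofReal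
  have e : ∀ x, ENNReal.ofReal
      (α * (‖weakDeriv 0 m x‖ ^ 2 + ‖weakDeriv 1 m x‖ ^ 2 + ‖r • weakDeriv 2 m x‖ ^ 2)
        + φ (field m x)) = ENNReal.ofReal (α * ‖weakDeriv 0 m x‖ ^ 2) +
        (ENNReal.ofReal (α * ‖weakDeriv 1 m x‖ ^ 2) +
        (ENNReal.ofReal (α * r ^ 2 * ‖weakDeriv 2 m x‖ ^ 2) +
          ENNReal.ofReal (φ (field m x)))) := by
    intro x
    have := hφ (field m x)
    rw [← ENNReal.ofReal_add (by positivity) this, ← ENNReal.ofReal_add (by positivity)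
      (by positivity), ← ENNReal.ofReal_add (by positivity) (by positivity), norm_smul, mul_pow,
      Real.norm_eq_abs, sq_abs]
    congr 1
    ring
  simp only [e]
  rw [lintegral_add_left (hmeas _ _), lintegral_add_left (hmeas _ _),
    lintegral_add_left (hmeas _ _), lintegral_ofReal_norm_sq hα, lintegral_ofReal_norm_sq hα,
    lintegral_ofReal_norm_sq (by positivity), lintegral_ofReal_norm_sq (by norm_num), norm_smul,
    mul_pow, Real.norm_eq_abs, sq_abs]
  have e2 : α * (‖weakDeriv 0 m‖ ^ 2 + ‖weakDeriv 1 m‖ ^ 2 + r ^ 2 * ‖weakDeriv 2 m‖ ^ 2)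
      + 1 / 2 * ‖h‖ ^ 2 = α * ‖weakDeriv 0 m‖ ^ 2 + (α * ‖weakDeriv 1 m‖ ^ 2 +
        (α * r ^ 2 * ‖weakDeriv 2 m‖ ^ 2 + 1 / 2 * ‖h‖ ^ 2)) := by ring
  rw [e2, ENNReal.ofReal_add (by positivity) (by positivity),
    ENNReal.ofReal_add (by positivity) (by positivity),
    ENNReal.ofReal_add (by positivity) (by positivity), anisotropy]
  ring

variable {ω : Opens E2} {α ms : ℝ} {φ : E3 → ℝ}

theorem Feps_of_mem (hα : 0 ≤ α) (hφ : ∀ v, 0 ≤ φ v) {ε : ℝ} {p : State ω}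
    (hp : p ∈ Ueps ω ms ε) : Feps ω α ms φ ε p =
      ENNReal.ofReal (α * (‖weakDeriv 0 p.1‖ ^ 2 + ‖weakDeriv 1 p.1‖ ^ 2 +
        ‖ε⁻¹ • weakDeriv 2 p.1‖ ^ 2) + 1 / 2 * ‖p.2‖ ^ 2) + anisotropy φ p.1 := by
  rw [Feps, if_pos hp, lintegral_energy hα hφ]

theorem F0_of_mem (hα : 0 ≤ α) (hφ : ∀ v, 0 ≤ φ v) {p : State ω} (hp : p ∈ U0 ω ms) :
    F0 ω α ms φ p = ENNReal.ofReal (α * (‖weakDeriv 0 p.1‖ ^ 2 + ‖weakDeriv 1 p.1‖ ^ 2)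
      + 1 / 2 * ‖p.2‖ ^ 2) + anisotropy φ p.1 := by
  have := lintegral_energy hα hφ 0 p.1 p.2
  simp only [zero_smul, norm_zero, ne_eq, OfNat.ofNat_ne_zero, not_false_eq_true, zero_pow,
    add_zero] at this
  rw [F0, if_pos hp, this]

/-- The film is the product of `ω` with the unit interval, up to the order of the coordinates. -/
theorem volume_film_ne_top (hω : volume (ω : Set E2) ≠ ∞) : volume (film ω : Set E3) ≠ ∞ := by
  let T : E3 → ℝ × (Fin 2 → ℝ) :=
    MeasurableEquiv.piFinSuccAbove (fun _ : Fin 3 => ℝ) 2 ∘ WithLp.ofLp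
  have hT : MeasurePreserving T volume volume :=
    (volume_preserving_piFinSuccAbove (fun _ : Fin 3 => ℝ) 2).comp
      (PiLp.volume_preserving_ofLp (Fin 3))
  have hS : MeasurableSet (WithLp.toLp 2 ⁻¹' (ω : Set E2) : Set (Fin 2 → ℝ)) :=
    (PiLp.volume_preserving_toLp (Fin 2)).measurable ω.isOpen.measurableSet
  have hpre : (film ω : Set E3) =
      T ⁻¹' (Set.Ioo 0 1 ×ˢ (WithLp.toLp 2 ⁻¹' (ω : Set E2) : Set (Fin 2 → ℝ))) := by
    ext x
    have e : (WithLp.toLp 2 (T x).2 : E2) = !₂[x 0, x 1] := by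
      ext i
      fin_cases i <;> rfl
    simp only [Set.mem_preimage, Set.mem_prod, e]
    exact and_comm
  rw [hpre, hT.measure_preimage (measurableSet_Ioo.prod hS).nullMeasurableSet,
    Measure.volume_eq_prod, Measure.prod_prod,
    (PiLp.volume_preserving_toLp (Fin 2)).measure_preimage ω.isOpen.nullMeasurableSet]
  exact ENNReal.mul_ne_top (by simp) hω

theorem norm_sq_field_of_saturated {p : W12 (film ω)} (hp : Saturated ms p) :
    ENNReal.ofReal (‖field p‖ ^ 2) = ENNReal.ofReal (ms ^ 2) * volume (film ω : Set E3) := by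
  have h := lintegral_ofReal_norm_sq zero_le_one (field p)
  simp only [one_mul] at h
  rw [← h, ← setLIntegral_const]
  refine lintegral_congr_ae ?_
  filter_upwards [hp] with x hx
  rw [hx]

/-- Bounded energy bounds the fields, and the vertical derivative by a multiple of `ε`. -/
theorem exists_bounds_of_Feps_le (hα : 0 < α) (hφ : ∀ v, 0 ≤ φ v) (ms : ℝ)
    {ε : ℕ → ℝ} (hε : ToZeroPlus ε) (C : ℝ≥0) : ∃ M : ℝ,
      ∀ (j : ℕ) (p : State ω), Feps ω α ms φ (ε j) p ≤ C →
        p ∈ Ueps ω ms (ε j) ∧ ‖p.1‖ ≤ M ∧ ‖p.2‖ ≤ M ∧ ‖weakDeriv 2 p.1‖ ≤ ε j * M := by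
  obtain ⟨E, hE⟩ := hε.2.bddAbove_range
  have hE' : ∀ j, ε j ≤ E := fun j => hE ⟨j, rfl⟩
  have hE0 : 0 < E := (hε.1 0).trans_le (hE' 0)
  set V : ℝ := ms ^ 2 * (volume (film ω : Set E3)).toReal with hV
  have hV0 : 0 ≤ V := by positivity
  set D : ℝ := C / α with hD
  have hD0 : 0 ≤ D := by positivity
  set S : ℝ := V + D + D + E ^ 2 * D + 2 * C + D with hS
  have hS0 : 0 ≤ S := by positivity
  have hC0 : (0 : ℝ) ≤ C := C.2
  have hED : 0 ≤ E ^ 2 * D := by positivity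
  refine ⟨√S, fun j p hp => ?_⟩
  have hmem : p ∈ Ueps ω ms (ε j) := by
    by_contra hn
    rw [Feps, if_neg hn] at hp
    exact absurd hp (by simp)
  rw [Feps_of_mem hα.le hφ hmem] at hp
  have h1 : α * (‖weakDeriv 0 p.1‖ ^ 2 + ‖weakDeriv 1 p.1‖ ^ 2 +
        ‖(ε j)⁻¹ • weakDeriv 2 p.1‖ ^ 2) + 1 / 2 * ‖p.2‖ ^ 2 ≤ C := by
    have := le_self_add.trans hp
    rwa [ENNReal.ofReal_le_coe] at this
  have hεj := hε.1 j
  set d : ℝ := ‖(ε j)⁻¹ • weakDeriv 2 p.1‖ with hd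
  have h2 : ‖weakDeriv 2 p.1‖ = ε j * d := by
    rw [hd, norm_smul, norm_inv, Real.norm_of_nonneg hεj.le, mul_inv_cancel_left₀ hεj.ne']
  have hd0 : 0 ≤ d := norm_nonneg _
  have bound : ∀ a : ℝ, α * a ≤ C → a ≤ D := fun a ha => by
    rw [hD, le_div_iff₀ hα]; linarith
  have q0 := sq_nonneg ‖weakDeriv 0 p.1‖
  have q1 := sq_nonneg ‖weakDeriv 1 p.1‖
  have q2 := sq_nonneg d
  have q3 := sq_nonneg ‖p.2‖
  have b : ‖weakDeriv 0 p.1‖ ^ 2 + ‖weakDeriv 1 p.1‖ ^ 2 + d ^ 2 ≤ D :=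
    bound _ (by linarith)
  have hh : ‖p.2‖ ^ 2 ≤ 2 * C := by
    have := mul_nonneg hα.le (add_nonneg (add_nonneg q0 q1) q2)
    linarith
  have hf : ‖field p.1‖ ^ 2 = V := by
    have := congrArg ENNReal.toReal (norm_sq_field_of_saturated hmem.2)
    rwa [ENNReal.toReal_mul, ENNReal.toReal_ofReal (sq_nonneg _),
      ENNReal.toReal_ofReal (sq_nonneg _)] at this
  have hd2 : ‖weakDeriv 2 p.1‖ ^ 2 ≤ E ^ 2 * D := by
    rw [h2, mul_pow]
    exact mul_le_mul (pow_le_pow_left₀ hεj.le (hE' j) 2) (by linarith) (sq_nonneg _)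
      (sq_nonneg _)
  refine ⟨hmem, Real.le_sqrt_of_sq_le ?_, Real.le_sqrt_of_sq_le ?_, ?_⟩
  · rw [norm_sq_W12, hf]
    linarith
  · linarith
  · rw [h2]
    exact mul_le_mul_of_nonneg_left (Real.le_sqrt_of_sq_le (by linarith)) hεj.le

end Energy

/-! ### Gamma-convergence and compactness -/

section Convergence

variable {ω : Opens E2} {α ms : ℝ} {φ : E3 → ℝ}

/-- Along a subsequence, bounded weakly convergent sequences in `W^{1,2}` converge almost
everywhere. -/
theorem exists_subseq_tendsto_ae {Ω : Opens E3} (hΩ : volume (Ω : Set E3) ≠ ∞) {m : ℕ → W12 Ω}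
    {m₀ : W12 Ω} {M : ℝ} (hM : ∀ j, ‖m j‖ ≤ M) (hm : WeaklyTendsto m m₀) :
    ∃ k : ℕ → ℕ, StrictMono k ∧ ∀ᵐ x ∂(volume.restrict (Ω : Set E3)),
      Tendsto (fun j => field (m (k j)) x) atTop (𝓝 (field m₀ x)) := by
  have hw : WeaklyTendsto (fun j => m j - m₀) 0 := by
    refine weaklyTendsto_iff.2 fun f => ?_
    have := (weaklyTendsto_iff.1 hm f).sub_const (f m₀)
    simpa using this
  have hlim := tendsto_lintegral_enorm_field hΩ (M := M + ‖m₀‖)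
    (fun j => (norm_sub_le _ _).trans (add_le_add_left (hM j) _)) hw
  have hmeas : TendstoInMeasure (volume.restrict (Ω : Set E3)) (fun j => field (m j)) atTop
      (field m₀) := by
    refine tendstoInMeasure_of_tendsto_eLpNorm one_ne_zero
      (fun j => (Lp.aestronglyMeasurable _)) (Lp.aestronglyMeasurable _) (hlim.congr fun j => ?_)
    rw [eLpNorm_one_eq_lintegral_enorm]
    refine lintegral_congr_ae ?_
    have e : field (m j - m₀) = field (m j) - field m₀ := rfl
    rw [e]
    filter_upwards [Lp.coeFn_sub (field (m j)) (field m₀)] with x hx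
    rw [hx]
  exact hmeas.exists_seq_tendsto_ae

theorem two_mul_inner_sub_norm_sq_le {H : Type*} [NormedAddCommGroup H] [InnerProductSpace ℝ H]
    (x y : H) :
    2 * inner ℝ x y - ‖x‖ ^ 2 ≤ ‖y‖ ^ 2 := by
  have := norm_sub_sq_real y x
  rw [real_inner_comm] at this
  nlinarith [sq_nonneg ‖y - x‖]

/-- Weak limits of sequences of bounded energy are admissible for the limit problem, and their
limit energy obeys the same bound. -/
theorem mem_U0_and_F0_le (hω : volume (ω : Set E2) ≠ ∞) (hα : 0 < α) (hφc : Continuous φ)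
    (hφ : ∀ v, 0 ≤ φ v) {ε : ℕ → ℝ} (hε : ToZeroPlus ε) {u : ℕ → State ω} {x : State ω}
    (hu : WeaklyTendsto u x) {C : ℝ≥0} (hC : ∀ j, Feps ω α ms φ (ε j) (u j) ≤ C) :
    x ∈ U0 ω ms ∧ F0 ω α ms φ x ≤ C := by
  obtain ⟨M, hM⟩ := exists_bounds_of_Feps_le hα hφ ms hε C
  have hM' := fun j => hM j (u j) (hC j)
  have hm : WeaklyTendsto (fun j => (u j).1) x.1 :=
    hu.map (ContinuousLinearMap.fst ℝ (W12 (film ω)) L2Space)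
  have hh : WeaklyTendsto (fun j => (u j).2) x.2 :=
    hu.map (ContinuousLinearMap.snd ℝ (W12 (film ω)) L2Space)
  obtain ⟨k, hk, hae⟩ := exists_subseq_tendsto_ae (volume_film_ne_top hω)
    (fun j => (hM' j).2.1) hm
  have hA : A0 (zeroExt x.1) x.2 = 0 :=
    A0_eq_zero_of_weaklyTendsto hε hm hh fun j => (hM' j).1.1
  have hsat : Saturated ms x.1 := by
    have hall : ∀ᵐ y ∂(volume.restrict (film ω : Set E3)), ∀ j, ‖field (u (k j)).1 y‖ = ms :=
      ae_all_iff.2 fun j => (hM' (k j)).1.2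
    filter_upwards [hae, hall] with y h1 h2
    refine tendsto_nhds_unique h1.norm ?_
    simp only [h2]
    exact tendsto_const_nhds
  have hd : weakDeriv 2 x.1 = 0 := by
    have hw := (hm.map (weakDerivL (film ω) 2)).inner_right (weakDeriv 2 x.1)
    have hz : Tendsto (fun j => ‖weakDeriv 2 x.1‖ * (ε j * M)) atTop (𝓝 0) := by
      simpa using (hε.2.mul_const M).const_mul ‖weakDeriv 2 x.1‖
    have hle : inner ℝ (weakDeriv 2 x.1) (weakDerivL (film ω) 2 x.1) ≤ 0 :=
      le_of_tendsto_of_tendsto' hw hz fun j => (real_inner_le_norm _ _).trans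
        (mul_le_mul_of_nonneg_left (hM' j).2.2.2 (norm_nonneg _))
    exact real_inner_self_nonpos.1 hle
  have hx : x ∈ U0 ω ms := ⟨hA, hd, hsat⟩
  refine ⟨hx, ?_⟩
  rw [F0_of_mem hα.le hφ hx]
  -- the quadratic terms are bounded below by their linearisations at the limit
  set a : ℕ → ℝ := fun j => α * ((2 * inner ℝ (weakDeriv 0 x.1) (weakDeriv 0 (u (k j)).1)
      - ‖weakDeriv 0 x.1‖ ^ 2) + (2 * inner ℝ (weakDeriv 1 x.1) (weakDeriv 1 (u (k j)).1)
      - ‖weakDeriv 1 x.1‖ ^ 2)) + 1 / 2 * (2 * inner ℝ x.2 (u (k j)).2 - ‖x.2‖ ^ 2) with ha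
  have halim : Tendsto a atTop (𝓝 (α * (‖weakDeriv 0 x.1‖ ^ 2 + ‖weakDeriv 1 x.1‖ ^ 2)
      + 1 / 2 * ‖x.2‖ ^ 2)) := by
    have t0 := ((hm.comp_strictMono hk).map (weakDerivL (film ω) 0)).inner_right (weakDeriv 0 x.1)
    have t1 := ((hm.comp_strictMono hk).map (weakDerivL (film ω) 1)).inner_right (weakDeriv 1 x.1)
    have t2 := (hh.comp_strictMono hk).inner_right x.2
    have t := ((((t0.const_mul 2).sub_const (‖weakDeriv 0 x.1‖ ^ 2)).add
      ((t1.const_mul 2).sub_const (‖weakDeriv 1 x.1‖ ^ 2))).const_mul α).add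
      (((t2.const_mul 2).sub_const (‖x.2‖ ^ 2)).const_mul (1 / 2))
    simp only [weakDerivL_apply, real_inner_self_eq_norm_sq] at t
    refine (congrArg (fun r => Tendsto a atTop (𝓝 r)) ?_).mp t
    ring
  have hlow : ∀ j, ENNReal.ofReal (a j) + anisotropy φ (u (k j)).1 ≤ C := by
    intro j
    refine le_trans ?_ (hC (k j))
    rw [Feps_of_mem hα.le hφ (hM' (k j)).1]
    refine add_le_add_left (ENNReal.ofReal_le_ofReal ?_) _
    have i0 := two_mul_inner_sub_norm_sq_le (weakDeriv 0 x.1) (weakDeriv 0 (u (k j)).1)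
    have i1 := two_mul_inner_sub_norm_sq_le (weakDeriv 1 x.1) (weakDeriv 1 (u (k j)).1)
    have i2 := two_mul_inner_sub_norm_sq_le x.2 (u (k j)).2
    have i3 := sq_nonneg ‖(ε (k j))⁻¹ • weakDeriv 2 (u (k j)).1‖
    refine add_le_add (mul_le_mul_of_nonneg_left (by linarith) hα.le) (by linarith)
  have hfatou : anisotropy φ x.1 ≤ liminf (fun j => anisotropy φ (u (k j)).1) atTop := by
    refine le_trans (le_of_eq ?_) (lintegral_liminf_le' fun j => ?_)
    · refine lintegral_congr_ae ?_
      filter_upwards [hae] with y hy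
      exact (((ENNReal.continuous_ofReal.comp hφc).tendsto _).comp hy).liminf_eq.symm
    · exact ((ENNReal.continuous_ofReal.comp hφc).measurable.comp
        (Lp.stronglyMeasurable _).measurable).aemeasurable
  have hlim := ENNReal.tendsto_ofReal halim
  have hquad := le_of_tendsto' hlim fun j => le_self_add.trans (hlow j)
  refine add_le_of_le_tsub_left_of_le hquad (hfatou.trans ?_)
  rw [← (ENNReal.Tendsto.sub tendsto_const_nhds hlim (Or.inl ENNReal.coe_ne_top)).liminf_eq]
  exact liminf_le_liminf (Eventually.of_forall fun j =>
    ENNReal.le_sub_of_add_le_left ENNReal.ofReal_ne_top (hlow j))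

/-- The liminf inequality: along a subsequence the energies stay below any constant exceeding their
lower limit. -/
theorem F0_le_liminf (hω : volume (ω : Set E2) ≠ ∞) (hα : 0 < α) (hφc : Continuous φ)
    (hφ : ∀ v, 0 ≤ φ v) {ε : ℕ → ℝ} (hε : ToZeroPlus ε) {u : ℕ → State ω} {x : State ω}
    (hu : WeaklyTendsto u x) :
    F0 ω α ms φ x ≤ liminf (fun j => Feps ω α ms φ (ε j) (u j)) atTop := by
  refine le_of_forall_gt fun c hc => ?_
  obtain ⟨C, hC1, hC2⟩ := ENNReal.lt_iff_exists_nnreal_btwn.1 hc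
  obtain ⟨k, hk, hkC⟩ := extraction_of_frequently_atTop 
    (frequently_lt_of_liminf_lt (by isBoundedDefault) hC1)
  exact ((mem_U0_and_F0_le hω hα hφc hφ (ε := ε ∘ k)
    ⟨fun j => hε.1 _, hε.2.comp hk.tendsto_atTop⟩ (hu.comp_strictMono hk)
    fun j => (hkC j).le).2).trans_lt hC2

/-- Recovery sequences keep the magnetisation and adapt the stray field. Since `∂₃ m = 0`, the
exchange energy does not depend on `ε`. -/
theorem exists_recovery_sequence (hα : 0 < α) (hφ : ∀ v, 0 ≤ φ v) {ε : ℕ → ℝ}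
    (hε : ToZeroPlus ε) (x : State ω) : ∃ u : ℕ → State ω, WeaklyTendsto u x ∧
      limsup (fun j => Feps ω α ms φ (ε j) (u j)) atTop ≤ F0 ω α ms φ x := by
  by_cases hx : x ∈ U0 ω ms
  · obtain ⟨H, hH, hw, hn⟩ := exists_strayField_tendsto hx.1 hε
    refine ⟨fun j => (x.1, H j), (weaklyTendsto_const x.1).prodMk hw, le_of_eq ?_⟩
    have e : ∀ j, Feps ω α ms φ (ε j) (x.1, H j) =
        ENNReal.ofReal (α * (‖weakDeriv 0 x.1‖ ^ 2 + ‖weakDeriv 1 x.1‖ ^ 2) + 1 / 2 * ‖H j‖ ^ 2)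
          + anisotropy φ x.1 := by
      intro j
      rw [Feps_of_mem hα.le hφ (p := (x.1, H j)) ⟨hH j, hx.2.2⟩]
      simp [hx.2.1]
    rw [F0_of_mem hα.le hφ hx]
    simp only [e]
    exact ((ENNReal.tendsto_ofReal ((hn.const_mul (1 / 2)).const_add _)).add
      tendsto_const_nhds).limsup_eq
  · refine ⟨fun _ => x, weaklyTendsto_const x, ?_⟩
    rw [F0, if_neg hx]
    exact le_top

theorem exists_subseq_of_Feps_le (hω : volume (ω : Set E2) ≠ ∞) (hα : 0 < α)
    (hφc : Continuous φ) (hφ : ∀ v, 0 ≤ φ v) {ε : ℕ → ℝ} (hε : ToZeroPlus ε) {u : ℕ → State ω}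
    {C : ℝ≥0} (hC : ∀ j, Feps ω α ms φ (ε j) (u j) ≤ C) :
    ∃ (k : ℕ → ℕ) (x : State ω), StrictMono k ∧ WeaklyTendsto (u ∘ k) x ∧ x ∈ U0 ω ms := by
  obtain ⟨M, hM⟩ := exists_bounds_of_Feps_le hα hφ ms hε C
  obtain ⟨k, m, hk, hm⟩ := exists_weaklyTendsto_subseq (u := fun j => (u j).1)
    fun j => (hM j (u j) (hC j)).2.1
  obtain ⟨l, h, hl, hh⟩ := exists_weaklyTendsto_subseq (u := fun j => (u (k j)).2)
    fun j => (hM (k j) (u (k j)) (hC (k j))).2.2.1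
  have hw : WeaklyTendsto (u ∘ (k ∘ l)) (m, h) := (hm.comp_strictMono hl).prodMk hh
  have hkl := hk.comp hl
  exact ⟨k ∘ l, (m, h), hkl, hw, (mem_U0_and_F0_le hω hα hφc hφ (ε := ε ∘ (k ∘ l))
    ⟨fun j => hε.1 _, hε.2.comp hkl.tendsto_atTop⟩ hw fun j => hC _).1⟩

end Convergence

end ThinFilm

end

theorem theorem2p1 (ω : TopologicalSpace.Opens ThinFilm.E2)
    (hω : MeasureTheory.volume (ω : Set ThinFilm.E2) = 1)
    (α ms : ℝ) (hα : 0 < α) (hms : 0 < ms)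
    (φ : ThinFilm.E3 → ℝ) (hφ : Continuous φ) (hφ_nonneg : ∀ v, 0 ≤ φ v) :
    ThinFilm.IsWeakGammaLimit (ThinFilm.Feps ω α ms φ) (ThinFilm.F0 ω α ms φ) ∧
    ∀ ε : ℕ → ℝ, ThinFilm.ToZeroPlus ε →
      ∀ (u : ℕ → ThinFilm.State ω) (C : ℝ≥0),
        (∀ j, ThinFilm.Feps ω α ms φ (ε j) (u j) ≤ C) →
        ∃ (k : ℕ → ℕ) (x : ThinFilm.State ω), StrictMono k ∧
          ThinFilm.WeaklyTendsto (u ∘ k) x ∧ x ∈ ThinFilm.U0 ω ms := by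
  have hω' : MeasureTheory.volume (ω : Set ThinFilm.E2) ≠ ∞ := by simp [hω]
  exact ⟨fun ε hε => ⟨fun x u hu => ThinFilm.F0_le_liminf hω' hα hφ hφ_nonneg hε hu,
      fun x => ThinFilm.exists_recovery_sequence hα hφ_nonneg hε x⟩,
    fun ε hε u C hC => ThinFilm.exists_subseq_of_Feps_le hω' hα hφ hφ_nonneg hε hC⟩
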